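/- **Conventions.** Let $\mathbb{S}=\{0,1\}^*$ be the set of finite binary strings (situations), with empty string $\square$ and length $|s|$, and let $\Omega=\{0,1\}^{\mathbb{N}}$ be the set of paths. For $\omega\in\Omega$, $\omega_{1:n}$ is its initial segment of length $n\in\mathbb{N}_0$. For $S\subseteq\mathbb{S}$, $[\![S]\!]$ is the set of paths with some initial segment in $S$. A forecasting system $\varphi$ assigns to each $s\in\mathbb{S}$ a non-empty closed interval $\varphi(s)=[\underline\varphi(s),\overline\varphi(s)]\subseteq[0,1]$. It is *computable* if the real maps $\underline\varphi,\overline\varphi$ on $\mathbb{S}$ are computable (a real map is computable if both it and its negative are pointwise limits of non-decreasing recursive sequences of rational maps), and *non-degenerate* if $\underline\varphi(s)<1$ and $\overline\varphi(s)>0$ for all $s\in\mathbb{S}$. A *supermartingale* for $\varphi$ is a map $M\colon\mathbb{S}\to\mathbb{R}$ such that $\max_{p\in\varphi(s)}\bigl[pM(s1)+(1-p)M(s0)\bigr]\le M(s)$ for all $s\in\mathbb{S}$; it is a *test supermartingale* if moreover $M\ge0$ and $M(\square)=1$. The *upper probability* of $G\subseteq\Omega$ is $$\overline{P}^\varphi(G)=\inf\Bigl\{M(\square):M\text{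 is a supermartingale for }\varphi\text{ and }\liminf_{n\to\infty}M(\omega_{1:n})\ge\mathbb{I}_G(\omega)\text{ for all }\omega\in\Omega\Bigr\}.$$ A *growth function* is a recursive, non-decreasing and unbounded map $\rho\colon\mathbb{N}_0\to\mathbb{N}_0$. A path $\omega$ is *Schnorr random* for $\varphi$ if there are no computable test supermartingale $T$ for $\varphi$ and growth function $\rho$ such that $\limsup_{n\to\infty}[T(\omega_{1:n})-\rho(n)]>0$. For $A\subseteq\mathbb{N}_0\times\mathbb{S}$ let $A_n=\{s:(n,s)\in A\}$ and $A_n^{<\ell}=\{s\in A_n:|s|<\ell\}$. A sequence $(G_n)_{n\in\mathbb{N}_0}$ of subsets of $\Omega$ is a *Schnorr test* for $\varphi$ if there is a recursive set $A\subseteq\mathbb{N}_0\times\mathbb{S}$ such that $G_n=[\![A_n]\!]$ and $\overline{P}^\varphi([\![A_n]\!])\le2^{-n}$ for all $n\in\mathbb{N}_0$, and there is a recursive map $e\colon\mathbb{N}_0^2\to\mathbb{N}_0$ such that $\overline{P}^\varphi([\![A_n]\!]\setminus[\![A_n^{<\ell}]\!])\le2^{-N}$ for all $N,n\in\mathbb{N}_0$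 and all $\ell\ge e(N,n)$. A path $\omega$ is *Schnorr test random* for $\varphi$ if $\omega\notin\bigcap_{n\in\mathbb{N}_0}G_n$ for every Schnorr test $(G_n)$ for $\varphi$. **Theorem.** Let $\varphi$ be a non-degenerate computable forecasting system and let $\omega\in\Omega$ be a path. Then $\omega$ is Schnorr random for $\varphi$ if and only if it is Schnorr test random for $\varphi$. -/

import Mathlib

namespace Forecasting

/-! ### Event tree -/

/-- Situations: finite binary strings, with `[]` the initial situation. The situation `s x` is
`s ++ [x]`, and the depth of `s` is `s.length`. -/
abbrev Situation : Type := List Bool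

/-- Paths: infinite binary sequences. The outcome at (one-based) position `k + 1` is `ω k`. -/
abbrev Path : Type := ℕ → Bool

/-- The situation consisting of the first `n` outcomes of the path `ω`. -/
def Path.upTo (ω : Path) (n : ℕ) : Situation := (List.range n).map ω

/-- The cylinder set of all paths that go through the situation `s`. -/
def cyl (s : Situation) : Set Path := {ω | ∃ n, ω.upTo n = s}

/-- The set of all paths that go through some situation in `S`. -/
def cylSet (S : Set Situation) : Set Path := ⋃ s ∈ S, cyl s

/-! ### Forecasts and supermartingales -/

/-- An interval forecast: a non-empty closed subinterval `[lower, upper]` of `[0, 1]`. -/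
@[ext]
structure IntervalForecast where
  lower : ℝ
  upper : ℝ
  lower_nonneg : 0 ≤ lower
  lower_le_upper : lower ≤ upper
  upper_le_one : upper ≤ 1

/-- The expectation `p f(1) + (1 - p) f(0)` of a gamble `f` on `{0, 1}`. -/
def localExp (p : ℝ) (f : Bool → ℝ) : ℝ := p * f true + (1 - p) * f false

/-- The local upper expectation: the maximum of `localExp p f` over `p ∈ I`. -/
noncomputable def localUpperExp (I : IntervalForecast) (f : Bool → ℝ) : ℝ :=
  sSup ((fun p => localExp p f) '' Set.Icc I.lower I.upper)

/-- The supremum in `localUpperExp` is always attained, so it is indeed a maximum. -/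
theorem isGreatest_localUpperExp (I : IntervalForecast) (f : Bool → ℝ) :
    IsGreatest ((fun p => localExp p f) '' Set.Icc I.lower I.upper) (localUpperExp I f) := by
  apply IsCompact.isGreatest_sSup
  · apply isCompact_Icc.image
    unfold localExp
    fun_prop
  · exact (Set.nonempty_Icc.2 I.lower_le_upper).image _

/-- A forecasting system assigns an interval forecast to every situation. -/
abbrev ForecastingSystem : Type := Situation → IntervalForecast

/-- The process difference of a real process `F`. -/
def processDiff (F : Situation → ℝ) (s : Situation) : Bool → ℝ :=
  fun x => F (s ++ [x]) - F s

/-- Supermartingales for `φ`; these are real-valued. -/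
def IsSupermartingale (φ : ForecastingSystem) (M : Situation → ℝ) : Prop :=
  ∀ s, localUpperExp (φ s) (processDiff M s) ≤ 0

/-- Test supermartingales: non-negative supermartingales with initial value one. -/
def IsTestSupermartingale (φ : ForecastingSystem) (T : Situation → ℝ) : Prop :=
  IsSupermartingale φ T ∧ (∀ s, 0 ≤ T s) ∧ T [] = 1

/-- The conditional upper expectation of `g` in the situation `s`: the infimum of `M s` over all
supermartingales `M` for `φ` with `g ω ≤ liminf M ω` for all paths `ω` through `s`. The limit
inferior of the capital may be infinite, so it and the infimum are taken in the extended reals;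
for bounded `g` the resulting upper expectation is a real number. -/
noncomputable def upperExp (φ : ForecastingSystem) (g : Path → ℝ) (s : Situation) : EReal :=
  sInf ((fun M : Situation → ℝ => (M s : EReal)) ''
    {M | IsSupermartingale φ M ∧ ∀ ω ∈ cyl s,
      (g ω : EReal) ≤ Filter.liminf (fun n => (M (ω.upTo n) : EReal)) Filter.atTop})

/-- The (unconditional) upper probability of a global event. -/
noncomputable def upperProb (φ : ForecastingSystem) (G : Set Path) : EReal :=
  upperExp φ (G.indicator 1) []

/-- A forecasting system is non-degenerate if it never forecasts `{0}` or `{1}`. -/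
def NonDegenerate (φ : ForecastingSystem) : Prop :=
  ∀ s, (φ s).lower < 1 ∧ 0 < (φ s).upper

/-! ### Computability -/

/-- A rational map is recursive if some algorithm computes, for every `d`, a code of the rational
number `q d`. Rationals are coded by triples of natural numbers, `(a, b, c)` standing for
`(a - b) / (c + 1)`. -/
def RecursiveRat {D : Type*} [Primcodable D] (q : D → ℚ) : Prop :=
  ∃ a b c : D → ℕ, Computable a ∧ Computable b ∧ Computable c ∧
    ∀ d, q d = ((a d : ℚ) - (b d : ℚ)) / ((c d : ℚ) + 1)

/-- A real map is lower semicomputable if it is the limit of a non-decreasing recursive sequence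
of rational maps. -/
def LowerSemicomputable {D : Type*} [Primcodable D] (r : D → ℝ) : Prop :=
  ∃ q : D × ℕ → ℚ, RecursiveRat q ∧ (∀ d n, q (d, n) ≤ q (d, n + 1)) ∧
    ∀ d, Filter.Tendsto (fun n => (q (d, n) : ℝ)) Filter.atTop (nhds (r d))

/-- A real map `r` is upper semicomputable if `-r` is lower semicomputable. -/
def UpperSemicomputable {D : Type*} [Primcodable D] (r : D → ℝ) : Prop :=
  LowerSemicomputable (fun d => -r d)

/-- A real map is computable if it is both lower and upper semicomputable. -/
def ComputableReal {D : Type*} [Primcodable D] (r : D → ℝ) : Prop :=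
  LowerSemicomputable r ∧ UpperSemicomputable r

/-- A forecasting system is computable if its lower and upper bounds are computable processes. -/
def ComputableSystem (φ : ForecastingSystem) : Prop :=
  ComputableReal (fun s => (φ s).lower) ∧ ComputableReal (fun s => (φ s).upper)

/-! ### Schnorr randomness -/

/-- Growth functions: recursive, non-decreasing and unbounded maps on the natural numbers. -/
def IsGrowthFunction (ρ : ℕ → ℕ) : Prop :=
  Computable ρ ∧ Monotone ρ ∧ ¬ BddAbove (Set.range ρ)

/-- A real sequence `μ` is computably unbounded if `limsup (μ n - ρ n) > 0` for some growth
function `ρ`. The limit superior may be infinite and is taken in the extended reals. -/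
def ComputablyUnbounded (μ : ℕ → ℝ) : Prop :=
  ∃ ρ : ℕ → ℕ, IsGrowthFunction ρ ∧
    0 < Filter.limsup (fun n => ((μ n - (ρ n : ℝ) : ℝ) : EReal)) Filter.atTop

/-- A path is Schnorr random for `φ` if no computable test supermartingale for `φ` is computably
unbounded on it. -/
def SchnorrRandom (φ : ForecastingSystem) (ω : Path) : Prop :=
  ∀ T : Situation → ℝ, IsTestSupermartingale φ T → ComputableReal T →
    ¬ ComputablyUnbounded (fun n => T (ω.upTo n))

/-! ### Schnorr test randomness -/

/-- The set of situations with index `n` in `A`. -/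
def sec (A : Set (ℕ × Situation)) (n : ℕ) : Set Situation := {s | (n, s) ∈ A}

/-- The situations with index `n` in `A` whose depth is less than `ℓ`. -/
def secLT (A : Set (ℕ × Situation)) (n ℓ : ℕ) : Set Situation :=
  sec A n ∩ {t | t.length < ℓ}

/-- A sequence of global events `G` is a Schnorr test for `φ` if it has a recursive
representation `A` with the required bounds on the upper probabilities, and a recursive tail
bound `e`. -/
def IsSchnorrTest (φ : ForecastingSystem) (G : ℕ → Set Path) : Prop :=
  ∃ A : Set (ℕ × Situation), ComputablePred (fun p => p ∈ A) ∧
    (∀ n, G n = cylSet (sec A n)) ∧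
    (∀ n, upperProb φ (cylSet (sec A n)) ≤ (((1 / 2 : ℝ) ^ n : ℝ) : EReal)) ∧
    ∃ e : ℕ × ℕ → ℕ, Computable e ∧ ∀ N n ℓ : ℕ, e (N, n) ≤ ℓ →
      upperProb φ (cylSet (sec A n) \ cylSet (secLT A n ℓ)) ≤ (((1 / 2 : ℝ) ^ N : ℝ) : EReal)

/-- A path is Schnorr test random for `φ` if it lies outside the intersection of every Schnorr
test for `φ`. -/
def SchnorrTestRandom (φ : ForecastingSystem) (ω : Path) : Prop :=
  ∀ G : ℕ → Set Path, IsSchnorrTest φ G → ω ∉ ⋂ n, G n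

end Forecasting

/-! Both directions translate between capital and upper probability. From a computable test
supermartingale `T` that beats a growth function `ρ` infinitely often, a Schnorr test arises from
the situations where `T` is approximately above `ρ` and `ρ` is above `2 ^ n`. Ville's inequality
(`upperProb_le_of_subset_cylSet`) bounds the upper probabilities, and the growth of `ρ` bounds the
tails: deep situations in the test carry large capital.

Conversely, let `ω` lie in every set of a Schnorr test. Pass to a fast subsequence `κ n` of the test
and cut depths into blocks `[L j, L (j + 1))` by computable levels. The event that the first visit
to the `κ n`-th set occurs in block `j` depends on finitely many outcomes, and the test bounds make
its upper probability tiny. Backward induction with rational outer approximations of the forecasts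
turns it into a computable rational supermartingale that starts small and equals one from such a
visit until the block is over and beyond (`ComputableSystem.exists_computable_supermartingale`).
Multiplied by `2 ^ j` and summed over all pairs `(n, j)`, these give a test supermartingale with
capital at least `2 ^ j` at the first visit of `ω`, more than a growth function that is at most `j`
on block `j`.

Non-degeneracy enters through `exists_supermartingale_bound`: non-negative capital in a situation is
at most a computable multiple of initial capital. This controls the tails of the sum, which makes it
computable, and it forces the first visits of `ω` to occur at arbitrarily large depths. -/

namespace Forecasting

/-! ### Computability tools -/

section ComputabilityTools

variable {α β σ : Type*} [Primcodable α] [Primcodable β] [Primcodable σ]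

theorem computable_nat_add {f g : α → ℕ} (hf : Computable f) (hg : Computable g) :
    Computable fun a => f a + g a :=
  Primrec.nat_add.to_comp.comp hf hg

theorem computable_nat_sub {f g : α → ℕ} (hf : Computable f) (hg : Computable g) :
    Computable fun a => f a - g a :=
  Primrec.nat_sub.to_comp.comp hf hg

theorem computable_nat_mul {f g : α → ℕ} (hf : Computable f) (hg : Computable g) :
    Computable fun a => f a * g a :=
  Primrec.nat_mul.to_comp.comp hf hg

theorem computable_nat_min {f g : α → ℕ} (hf : Computable f) (hg : Computable g) :
    Computable fun a => min (f a) (g a) :=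
  Primrec.nat_min.to_comp.comp hf hg

theorem computable_nat_pow {f g : α → ℕ} (hf : Computable f) (hg : Computable g) :
    Computable fun a => f a ^ g a :=
  (Primrec₂.unpaired'.1 Nat.Primrec.pow).to_comp.comp hf hg

theorem computablePred_nat_le {f g : α → ℕ} (hf : Computable f) (hg : Computable g) :
    ComputablePred fun a => f a ≤ g a :=
  Computable.computablePred (Primrec.nat_le.decide.to_comp.comp hf hg)

theorem computablePred_nat_lt {f g : α → ℕ} (hf : Computable f) (hg : Computable g) :
    ComputablePred fun a => f a < g a :=
  computablePred_nat_le (Computable.succ.comp hf) hg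

theorem computablePred_and {p q : α → Prop} (hp : ComputablePred p) (hq : ComputablePred q) :
    ComputablePred fun a => p a ∧ q a := by
  classical
  refine Computable.computablePred ((Primrec.and.to_comp.comp hp.decide hq.decide).of_eq fun a => ?_)
  by_cases p a <;> by_cases q a <;> simp [*]

theorem computablePred_comp {p : β → Prop} {f : α → β} (hp : ComputablePred p)
    (hf : Computable f) : ComputablePred fun a => p (f a) := by
  classical
  exact Computable.computablePred (hp.decide.comp hf)

theorem computable_ite {p : α → Prop} [DecidablePred p] {f g : α → σ}
    (hp : ComputablePred p) (hf : Computable f) (hg : Computable g) :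
    Computable fun a => if p a then f a else g a := by
  simpa [Bool.cond_decide] using hp.decide.cond hf hg

theorem computable_sum_range {f : α → ℕ → ℕ} {n : α → ℕ}
    (hf : Computable fun p : α × ℕ => f p.1 p.2) (hn : Computable n) :
    Computable fun a => ∑ i ∈ Finset.range (n a), f a i := by
  have h : Computable₂ fun (a : α) (p : ℕ × ℕ) => p.2 + f a p.1 :=
    computable_nat_add (Computable.snd.comp Computable.snd)
      (hf.comp (Computable.fst.pair (Computable.fst.comp Computable.snd)))
  refine (Computable.nat_rec hn (Computable.const 0) h).of_eq fun a => ?_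
  induction n a with
  | zero => rfl
  | succ k ih => rw [Finset.sum_range_succ, ← ih]

theorem computable_prod_range {f : α → ℕ → ℕ} {n : α → ℕ}
    (hf : Computable fun p : α × ℕ => f p.1 p.2) (hn : Computable n) :
    Computable fun a => ∏ i ∈ Finset.range (n a), f a i := by
  have h : Computable₂ fun (a : α) (p : ℕ × ℕ) => p.2 * f a p.1 :=
    computable_nat_mul (Computable.snd.comp Computable.snd)
      (hf.comp (Computable.fst.pair (Computable.fst.comp Computable.snd)))
  refine (Computable.nat_rec hn (Computable.const 1) h).of_eq fun a => ?_
  induction n a with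
  | zero => rfl
  | succ k ih => rw [Finset.prod_range_succ, ← ih]

/-- A bounded search succeeds exactly when the sum of the indicators over the search range is
positive. -/
theorem computablePred_exists_lt {p : α → ℕ → Prop} {n : α → ℕ}
    (hp : ComputablePred fun x : α × ℕ => p x.1 x.2) (hn : Computable n) :
    ComputablePred fun a => ∃ k < n a, p a k := by
  classical
  have h := computable_sum_range (f := fun a k => if p a k then 1 else 0)
    (computable_ite hp (Computable.const 1) (Computable.const 0)) hn
  refine (computablePred_nat_lt (Computable.const 0) h).of_eq fun a => ?_
  simp [Finset.Nonempty]

/-- Search for a natural number satisfying a computable condition. -/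
theorem exists_computable_choice {p : α → ℕ → Prop}
    (hp : ComputablePred fun x : α × ℕ => p x.1 x.2) (h : ∀ a, ∃ n, p a n) :
    ∃ f : α → ℕ, Computable f ∧ ∀ a, p a (f a) := by
  classical
  exact ⟨_, Computable.find hp h, fun a => Nat.find_spec (h a)⟩

open Nat.Partrec (Code)

/-- Kleene's second recursion theorem for partial functions between coded types. -/
theorem exists_code_fixed_point {F : Code → α →. β} (hF : Partrec₂ F) :
    ∃ c : Code, ∀ a, c.eval (Encodable.encode a) = (F c a).map Encodable.encode := by
  have h : Partrec₂ fun (c : Code) (n : ℕ) =>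
      (Part.ofOption (Encodable.decode (α := α) n)).bind
        fun a => (F c a).map Encodable.encode := by
    refine Partrec.bind (f := fun x : Code × ℕ => (Encodable.decode (α := α) x.2 : Part α))
      (g := fun (x : Code × ℕ) a => (F x.1 a).map Encodable.encode) ?_ ?_
    · exact (Computable.decode.comp Computable.snd).ofOption
    · exact (hF.comp (Computable.fst.comp Computable.fst) Computable.snd).map
        (Computable.encode.comp Computable.snd)
  obtain ⟨c, hc⟩ := Code.fixed_point₂ h
  exact ⟨c, fun a => by simp [hc]⟩

/-- Backward recursion over the binary tree in which `s` has the two children `l s` and `r s`. -/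
def treeRec (base : σ → β) (l r : σ → σ) (step : σ → β → β → β) : ℕ → σ → β
  | 0, s => base s
  | h + 1, s => step s (treeRec base l r step h (l s)) (treeRec base l r step h (r s))

/-- The recursion changes its argument `s` and branches, so it is not a plain `Computable.nat_rec`.
The recursion theorem supplies a code that evaluates itself on both children; induction on the
number of steps shows that it halts with the right value. -/
theorem computable_treeRec {base : σ → β} {l r : σ → σ} {step : σ → β → β → β}
    (hb : Computable base) (hl : Computable l) (hr : Computable r)
    (hs : Computable fun p : σ × β × β => step p.1 p.2.1 p.2.2) :
    Computable fun p : ℕ × σ => treeRec base l r step p.1 p.2 := by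
  let child (c : Code) (x : ℕ × σ) : Part β :=
    (c.eval (Encodable.encode x)).bind fun u => (Encodable.decode (α := β) u : Part β)
  have hchild : Partrec₂ child := by
    refine Partrec.bind (f := fun y : Code × ℕ × σ => y.1.eval (Encodable.encode y.2))
      (g := fun (y : Code × ℕ × σ) u => (Encodable.decode (α := β) u : Part β)) ?_ ?_
    · exact Code.eval_part.comp Computable.fst (Computable.encode.comp Computable.snd)
    · exact (Computable.decode.comp Computable.snd).ofOption
  let F (c : Code) (x : ℕ × σ) : Part β :=
    Nat.casesOn (motive := fun _ => Part β) x.1 (Part.some (base x.2)) fun h =>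
      (child c (h, l x.2)).bind fun u => (child c (h, r x.2)).map fun v => step x.2 u v
  have hF : Partrec₂ F := by
    refine Partrec.nat_casesOn_right (f := fun y : Code × ℕ × σ => y.2.1)
      (g := fun y => base y.2.2)
      (h := fun y h => (child y.1 (h, l y.2.2)).bind fun u =>
        (child y.1 (h, r y.2.2)).map fun v => step y.2.2 u v) ?_ ?_ ?_
    · exact Computable.fst.comp Computable.snd
    · exact hb.comp (Computable.snd.comp Computable.snd)
    · have h1 : Computable fun z : (Code × ℕ × σ) × ℕ => z.1.2.2 :=
        Computable.snd.comp (Computable.snd.comp Computable.fst)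
      refine Partrec.bind (f := fun z : (Code × ℕ × σ) × ℕ => child z.1.1 (z.2, l z.1.2.2))
        (g := fun z u => (child z.1.1 (z.2, r z.1.2.2)).map fun v => step z.1.2.2 u v) ?_ ?_
      · exact hchild.comp (Computable.fst.comp Computable.fst) (Computable.snd.pair (hl.comp h1))
      · refine Partrec.map
          (f := fun w : ((Code × ℕ × σ) × ℕ) × β => child w.1.1.1 (w.1.2, r w.1.1.2.2))
          (g := fun w v => step w.1.1.2.2 w.2 v) ?_ ?_
        · exact (hchild.comp (Computable.fst.comp Computable.fst)
            (Computable.snd.pair (hr.comp h1))).comp Computable.fst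
        · have h2 : Computable fun q : (((Code × ℕ × σ) × ℕ) × β) × β =>
              (q.1.1.1.2.2, q.1.2, q.2) :=
            (h1.comp (Computable.fst.comp Computable.fst)).pair
              ((Computable.snd.comp Computable.fst).pair Computable.snd)
          have h3 := Computable.comp hs h2
          exact h3
  obtain ⟨c, hc⟩ := exists_code_fixed_point hF
  have key : ∀ h s, F c (h, s) = Part.some (treeRec base l r step h s) := by
    intro h
    induction h with
    | zero => intro s; rfl
    | succ k ih =>
      intro s
      have hch : ∀ s, child c (k, s) = Part.some (treeRec base l r step k s) := fun s => by
        change (c.eval (Encodable.encode (k, s))).bind _ = _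
        rw [hc, ih]
        simp
      change ((child c (k, l s)).bind fun u => (child c (k, r s)).map fun v => step s u v) = _
      rw [hch, hch]
      simp [treeRec]
  have hpart : Partrec fun x : ℕ × σ => F c x := hF.comp (Computable.const c) Computable.id
  exact hpart.of_eq_tot fun x => by
    rw [show F c x = _ from key x.1 x.2]; exact Part.mem_some _

end ComputabilityTools

/-! ### Recursive rational maps -/

section RecursiveRat

variable {D E : Type*} [Primcodable D] [Primcodable E]

theorem RecursiveRat.comp {q : E → ℚ} (hq : RecursiveRat q) {f : D → E} (hf : Computable f) :
    RecursiveRat fun d => q (f d) := by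
  obtain ⟨a, b, c, ha, hb, hc, h⟩ := hq
  exact ⟨_, _, _, ha.comp hf, hb.comp hf, hc.comp hf, fun d => h (f d)⟩

theorem RecursiveRat.neg {q : D → ℚ} (hq : RecursiveRat q) : RecursiveRat fun d => -q d := by
  obtain ⟨a, b, c, ha, hb, hc, h⟩ := hq
  exact ⟨b, a, c, hb, ha, hc, fun d => by
    simp only [h, ← neg_div, neg_sub]⟩

theorem RecursiveRat.add {q r : D → ℚ} (hq : RecursiveRat q) (hr : RecursiveRat r) :
    RecursiveRat fun d => q d + r d := by
  obtain ⟨a, b, c, ha, hb, hc, h⟩ := hq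
  obtain ⟨a', b', c', ha', hb', hc', h'⟩ := hr
  have sc := Computable.succ.comp hc
  have sc' := Computable.succ.comp hc'
  -- The coded denominator is `c + 1`, hence the final `- 1`; the product is positive, so truncated
  -- subtraction is exact.
  refine ⟨fun d => a d * (c' d).succ + a' d * (c d).succ,
    fun d => b d * (c' d).succ + b' d * (c d).succ, fun d => (c d).succ * (c' d).succ - 1,
    computable_nat_add (computable_nat_mul ha sc') (computable_nat_mul ha' sc),
    computable_nat_add (computable_nat_mul hb sc') (computable_nat_mul hb' sc),
    computable_nat_sub (computable_nat_mul sc sc') (Computable.const 1), fun d => ?_⟩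
  simp only [h, h', Nat.cast_sub (Nat.mul_pos (Nat.succ_pos (c d)) (Nat.succ_pos (c' d)))]
  push_cast
  have h1 : (c d : ℚ) + 1 ≠ 0 := by positivity
  have h2 : (c' d : ℚ) + 1 ≠ 0 := by positivity
  field_simp
  ring

theorem RecursiveRat.sub {q r : D → ℚ} (hq : RecursiveRat q) (hr : RecursiveRat r) :
    RecursiveRat fun d => q d - r d := by
  simpa only [sub_eq_add_neg] using hq.add hr.neg

theorem recursiveRat_div_succ {f g : D → ℕ} (hf : Computable f) (hg : Computable g) :
    RecursiveRat fun d => (f d : ℚ) / ((g d : ℚ) + 1) :=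
  ⟨f, fun _ => 0, g, hf, Computable.const 0, hg, fun d => by simp⟩

theorem recursiveRat_natCast {f : D → ℕ} (hf : Computable f) :
    RecursiveRat fun d => (f d : ℚ) := by
  simpa using recursiveRat_div_succ hf (Computable.const 0)

theorem RecursiveRat.computablePred_le {q r : D → ℚ} (hq : RecursiveRat q)
    (hr : RecursiveRat r) : ComputablePred fun d => q d ≤ r d := by
  obtain ⟨a, b, c, ha, hb, hc, h⟩ := hr.sub hq
  refine (computablePred_nat_le hb ha).of_eq fun d => ?_
  have h1 : (0 : ℚ) < (c d : ℚ) + 1 := by positivity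
  rw [← sub_nonneg (a := r d), show r d - q d = _ from h d, le_div_iff₀ h1, zero_mul, sub_nonneg, Nat.cast_le]

theorem RecursiveRat.computablePred_lt {q r : D → ℚ} (hq : RecursiveRat q)
    (hr : RecursiveRat r) : ComputablePred fun d => q d < r d :=
  (hr.computablePred_le hq).not.of_eq fun _ => not_le

end RecursiveRat

/-! ### Codes of non-negative rationals -/

/-- The pair `(a, b)` codes the non-negative rational `a / (b + 1)`. -/
abbrev Frac : Type := ℕ × ℕ

namespace Frac

/-- The rational number coded by `x`. -/
def val (x : Frac) : ℚ := (x.1 : ℚ) / ((x.2 : ℚ) + 1)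

def add (x y : Frac) : Frac :=
  (x.1 * (y.2 + 1) + y.1 * (x.2 + 1), (x.2 + 1) * (y.2 + 1) - 1)

def mul (x y : Frac) : Frac := (x.1 * y.1, (x.2 + 1) * (y.2 + 1) - 1)

/-- The code of `1 - x`, truncated at zero. -/
def compl (x : Frac) : Frac := (x.2 + 1 - x.1, x.2)

def sup (x y : Frac) : Frac := if x.1 * (y.2 + 1) ≤ y.1 * (x.2 + 1) then y else x

/-- The larger one of the expectations of the gamble with values `a` on `1` and `b` on `0` for
the probabilities `p.1` and `p.2`. -/
def upperExp (p : Frac × Frac) (a b : Frac) : Frac :=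
  sup (add (mul p.1 a) (mul (compl p.1) b)) (add (mul p.2 a) (mul (compl p.2) b))

theorem val_nonneg (x : Frac) : 0 ≤ x.val := by
  unfold val; positivity

@[simp]
theorem val_mk_zero (n : ℕ) : val (n, 0) = n := by simp [val]

@[simp]
theorem val_add (x y : Frac) : (add x y).val = x.val + y.val := by
  have h1 : (x.2 : ℚ) + 1 ≠ 0 := by positivity
  have h2 : (y.2 : ℚ) + 1 ≠ 0 := by positivity
  unfold val add
  rw [Nat.cast_sub (Nat.mul_pos (Nat.succ_pos _) (Nat.succ_pos _))]
  push_cast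
  field_simp
  ring

@[simp]
theorem val_mul (x y : Frac) : (mul x y).val = x.val * y.val := by
  have h1 : (x.2 : ℚ) + 1 ≠ 0 := by positivity
  have h2 : (y.2 : ℚ) + 1 ≠ 0 := by positivity
  unfold val mul
  rw [Nat.cast_sub (Nat.mul_pos (Nat.succ_pos _) (Nat.succ_pos _))]
  push_cast
  field_simp
  ring

theorem val_compl {x : Frac} (hx : x.val ≤ 1) : (compl x).val = 1 - x.val := by
  have h1 : (0 : ℚ) < (x.2 : ℚ) + 1 := by positivity
  unfold val at hx
  rw [div_le_one h1] at hx
  have h2 : x.1 ≤ x.2 + 1 := by exact_mod_cast hx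
  unfold val compl
  rw [Nat.cast_sub h2]
  push_cast
  field_simp

@[simp]
theorem val_sup (x y : Frac) : (sup x y).val = max x.val y.val := by
  have h1 : (0 : ℚ) < (x.2 : ℚ) + 1 := by positivity
  have h2 : (0 : ℚ) < (y.2 : ℚ) + 1 := by positivity
  have h : x.1 * (y.2 + 1) ≤ y.1 * (x.2 + 1) ↔ x.val ≤ y.val := by
    unfold val
    rw [div_le_div_iff₀ h1 h2]
    exact_mod_cast Iff.rfl
  unfold sup
  split_ifs with h'
  · rw [max_eq_right (h.1 h')]
  · rw [max_eq_left (le_of_not_ge fun h'' => h' (h.2 h''))]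

section Computable

variable {D : Type*} [Primcodable D] {f g : D → Frac}

theorem computable_add (hf : Computable f) (hg : Computable g) :
    Computable fun d => add (f d) (g d) := by
  have f1 := Computable.fst.comp hf
  have f2 := Computable.succ.comp (Computable.snd.comp hf)
  have g1 := Computable.fst.comp hg
  have g2 := Computable.succ.comp (Computable.snd.comp hg)
  exact (computable_nat_add (computable_nat_mul f1 g2) (computable_nat_mul g1 f2)).pair
    (computable_nat_sub (computable_nat_mul f2 g2) (Computable.const 1))

theorem computable_mul (hf : Computable f) (hg : Computable g) :
    Computable fun d => mul (f d) (g d) := by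
  have f2 := Computable.succ.comp (Computable.snd.comp hf)
  have g2 := Computable.succ.comp (Computable.snd.comp hg)
  exact (computable_nat_mul (Computable.fst.comp hf) (Computable.fst.comp hg)).pair
    (computable_nat_sub (computable_nat_mul f2 g2) (Computable.const 1))

theorem computable_compl (hf : Computable f) : Computable fun d => compl (f d) := by
  have f2 := Computable.snd.comp hf
  exact (computable_nat_sub (Computable.succ.comp f2) (Computable.fst.comp hf)).pair f2

theorem computable_sup (hf : Computable f) (hg : Computable g) :
    Computable fun d => sup (f d) (g d) := by
  have f1 := Computable.fst.comp hf
  have f2 := Computable.succ.comp (Computable.snd.comp hf)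
  have g1 := Computable.fst.comp hg
  have g2 := Computable.succ.comp (Computable.snd.comp hg)
  exact computable_ite (computablePred_nat_le (computable_nat_mul f1 g2)
    (computable_nat_mul g1 f2)) hg hf

theorem computable_upperExp {p : D → Frac × Frac} (hp : Computable p) (hf : Computable f)
    (hg : Computable g) : Computable fun d => upperExp (p d) (f d) (g d) := by
  have h1 := Computable.fst.comp hp
  have h2 := Computable.snd.comp hp
  exact computable_sup
    (computable_add (computable_mul h1 hf) (computable_mul (computable_compl h1) hg))
    (computable_add (computable_mul h2 hf) (computable_mul (computable_compl h2) hg))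

theorem exists_computable_sum_range {F : D → ℕ → Frac}
    (hF : Computable fun p : D × ℕ => F p.1 p.2) :
    ∃ G : D × ℕ → Frac, Computable G ∧
      ∀ d n, (G (d, n)).val = ∑ i ∈ Finset.range n, (F d i).val := by
  have h : Computable₂ fun (a : D × ℕ) (p : ℕ × Frac) => add p.2 (F a.1 p.1) :=
    computable_add (Computable.snd.comp Computable.snd)
      (hF.comp ((Computable.fst.comp Computable.fst).pair
        (Computable.fst.comp Computable.snd)))
  refine ⟨_, Computable.nat_rec Computable.snd (Computable.const (0, 0)) h, fun d n => ?_⟩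
  induction n with
  | zero => simp
  | succ k ih =>
    rw [Finset.sum_range_succ, ← ih]
    exact val_add _ _

theorem recursiveRat_val (hf : Computable f) : RecursiveRat fun d => (f d).val :=
  recursiveRat_div_succ (Computable.fst.comp hf) (Computable.snd.comp hf)

end Computable

/-- A recursive rational map can be truncated to the unit interval. -/
theorem exists_computable_clip {D : Type*} [Primcodable D] {q : D → ℚ} (hq : RecursiveRat q) :
    ∃ f : D → Frac, Computable f ∧ ∀ d, (f d).val = max 0 (min 1 (q d)) := by
  obtain ⟨a, b, c, ha, hb, hc, h⟩ := hq
  -- Truncated subtraction yields the maximum with zero, and capping the numerator by the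
  -- denominator the minimum with one.
  refine ⟨fun d => (min (c d).succ (a d - b d), c d),
    (computable_nat_min (Computable.succ.comp hc) (computable_nat_sub ha hb)).pair hc,
    fun d => ?_⟩
  have h1 : (0 : ℚ) < (c d : ℚ) + 1 := by positivity
  have h2 : ((a d - b d : ℕ) : ℚ) = max 0 ((a d : ℚ) - b d) := by
    rcases le_total (b d) (a d) with h3 | h3
    · rw [Nat.cast_sub h3, max_eq_right (by rw [sub_nonneg]; exact_mod_cast h3)]
    · rw [Nat.sub_eq_zero_of_le h3, max_eq_left (by rw [sub_nonpos]; exact_mod_cast h3)]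
      simp
  rw [h, val]
  push_cast
  rw [h2, ← min_div_div_right h1.le, div_self h1.ne', ← max_div_div_right h1.le,
    zero_div, max_min_distrib_left, max_eq_right (zero_le_one' ℚ)]

end Frac

/-! ### Paths and cylinders -/

theorem Path.upTo_succ (ω : Path) (n : ℕ) : ω.upTo (n + 1) = ω.upTo n ++ [ω n] := by
  simp [Path.upTo, List.range_succ]

@[simp]
theorem Path.length_upTo (ω : Path) (n : ℕ) : (ω.upTo n).length = n := by
  simp [Path.upTo]

theorem Path.take_upTo (ω : Path) (k n : ℕ) : (ω.upTo n).take k = ω.upTo (min k n) := by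
  simp [Path.upTo, ← List.map_take, List.take_range]

theorem mem_cyl_iff {ω : Path} {s : Situation} : ω ∈ cyl s ↔ ω.upTo s.length = s := by
  refine ⟨?_, fun h => ⟨_, h⟩⟩
  rintro ⟨n, rfl⟩
  simp

theorem mem_cyl_nil (ω : Path) : ω ∈ cyl [] := ⟨0, rfl⟩

theorem mem_cylSet_iff {ω : Path} {S : Set Situation} :
    ω ∈ cylSet S ↔ ∃ n, ω.upTo n ∈ S := by
  simp only [cylSet, Set.mem_iUnion, exists_prop]
  constructor
  · rintro ⟨_, hs, n, rfl⟩
    exact ⟨n, hs⟩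
  · rintro ⟨n, hn⟩
    exact ⟨_, hn, n, rfl⟩

/-! ### Supermartingales -/

theorem isSupermartingale_iff {φ : ForecastingSystem} {M : Situation → ℝ} :
    IsSupermartingale φ M ↔ ∀ s, ∀ p ∈ Set.Icc (φ s).lower (φ s).upper,
      p * M (s ++ [true]) + (1 - p) * M (s ++ [false]) ≤ M s := by
  refine forall_congr' fun s => ?_
  rw [isLUB_le_iff (isGreatest_localUpperExp (φ s) (processDiff M s)).isLUB, mem_upperBounds,
    Set.forall_mem_image]
  refine forall₂_congr fun p _ => ?_
  simp only [localExp, processDiff]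
  constructor <;> intro h <;> linarith

namespace IsSupermartingale

variable {φ : ForecastingSystem} {M : Situation → ℝ}

theorem const_mul (hM : IsSupermartingale φ M) {c : ℝ} (hc : 0 ≤ c) :
    IsSupermartingale φ fun s => c * M s := by
  rw [isSupermartingale_iff] at *
  intro s p hp
  have := mul_le_mul_of_nonneg_left (hM s p hp) hc
  linarith

theorem exists_append_le (hM : IsSupermartingale φ M) (s : Situation) :
    ∃ x, M (s ++ [x]) ≤ M s := by
  by_contra! h
  have h1 := isSupermartingale_iff.1 hM s (φ s).lower ⟨le_rfl, (φ s).lower_le_upper⟩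
  have h2 := (φ s).lower_nonneg
  have h3 := (φ s).lower_le_upper.trans (φ s).upper_le_one
  nlinarith [mul_nonneg h2 (sub_nonneg.2 (h true).le),
    mul_nonneg (sub_nonneg.2 h3) (sub_nonneg.2 (h false).le), h true, h false]

/-- Some path through `s` never has more capital than in `s` from there on. -/
theorem exists_path_le (hM : IsSupermartingale φ M) (s : Situation) :
    ∃ ω ∈ cyl s, ∀ n, s.length ≤ n → M (ω.upTo n) ≤ M s := by
  choose next hnext using hM.exists_append_le
  let u : ℕ → Situation := fun k => Nat.rec s (fun _ t => t ++ [next t]) k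
  let ω : Path := fun n => if h : n < s.length then s[n] else next (u (n - s.length))
  have h0 : ω.upTo s.length = s := by
    refine List.ext_getElem (by simp) fun i h1 h2 => ?_
    simp [Path.upTo, ω, h2]
  have hu : ∀ k, ω.upTo (s.length + k) = u k := by
    intro k
    induction k with
    | zero => exact h0
    | succ k ih =>
      rw [← add_assoc, Path.upTo_succ, ih]
      simp [ω, u]
  have hle : ∀ k, M (u k) ≤ M s := by
    intro k
    induction k with
    | zero => exact le_rfl
    | succ k ih => exact (hnext (u k)).trans ih
  refine ⟨ω, ⟨_, h0⟩, fun n hn => ?_⟩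
  obtain ⟨k, rfl⟩ := Nat.exists_eq_add_of_le hn
  rw [hu]
  exact hle k

/-- The path of `exists_path_le` keeps the limit inferior at or below `M s`. This turns hedging
conditions on paths into bounds in situations. -/
theorem le_of_le_liminf (hM : IsSupermartingale φ M) {s : Situation} {c : ℝ}
    (h : ∀ ω ∈ cyl s, (c : EReal) ≤
      Filter.liminf (fun n => (M (ω.upTo n) : EReal)) Filter.atTop) : c ≤ M s := by
  obtain ⟨ω, hω, hle⟩ := hM.exists_path_le s
  have h1 : Filter.liminf (fun n => (M (ω.upTo n) : EReal)) Filter.atTop ≤ (M s : EReal) := by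
    refine Filter.liminf_le_of_frequently_le' (Filter.Eventually.frequently ?_)
    filter_upwards [Filter.eventually_ge_atTop s.length] with n hn
    exact_mod_cast hle n hn
  exact_mod_cast (h ω hω).trans h1

end IsSupermartingale

/-- The supermartingales in the definition of the upper probability of `G`. -/
def Superhedges (φ : ForecastingSystem) (G : Set Path) (M : Situation → ℝ) : Prop :=
  IsSupermartingale φ M ∧ ∀ ω, ((G.indicator 1 ω : ℝ) : EReal) ≤
    Filter.liminf (fun n => (M (ω.upTo n) : EReal)) Filter.atTop

namespace Superhedges

variable {φ : ForecastingSystem} {G : Set Path} {M : Situation → ℝ}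

theorem upperProb_le (h : Superhedges φ G M) : upperProb φ G ≤ (M [] : EReal) :=
  sInf_le ⟨M, ⟨h.1, fun ω _ => h.2 ω⟩, rfl⟩

theorem nonneg (h : Superhedges φ G M) (s : Situation) : 0 ≤ M s := by
  refine h.1.le_of_le_liminf fun ω _ => le_trans ?_ (h.2 ω)
  exact_mod_cast Set.indicator_nonneg (fun _ _ => zero_le_one) ω

theorem one_le (h : Superhedges φ G M) {s : Situation} (hs : cyl s ⊆ G) : 1 ≤ M s := by
  refine h.1.le_of_le_liminf fun ω hω => le_trans ?_ (h.2 ω)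
  simp [hs hω]

end Superhedges

theorem le_upperProb {φ : ForecastingSystem} {G : Set Path} {c : ℝ}
    (h : ∀ M, Superhedges φ G M → c ≤ M []) : (c : EReal) ≤ upperProb φ G := by
  refine le_sInf ?_
  rintro _ ⟨M, hM, rfl⟩
  exact EReal.coe_le_coe_iff.2 (h M ⟨hM.1, fun ω => hM.2 ω (mem_cyl_nil ω)⟩)

/-! ### Stopped supermartingales and Ville's inequality -/

open Classical in
/-- The process `M`, stopped in the first situation in `B`. -/
noncomputable def stopped (B : Set Situation) (M : Situation → ℝ) (s : Situation) : ℝ :=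
  if h : ∃ k, k ≤ s.length ∧ s.take k ∈ B then M (s.take (Nat.find h)) else M s

section Stopped

variable {B : Set Situation} {M : Situation → ℝ}

theorem stopped_nil : stopped B M [] = M [] := by
  unfold stopped
  split_ifs <;> simp

theorem le_stopped {c : ℝ} {s : Situation} (hM : ∀ s, c ≤ M s) : c ≤ stopped B M s := by
  unfold stopped
  split_ifs <;> exact hM _

theorem le_stopped_of_take_mem {c : ℝ} {s : Situation} {k : ℕ} (hk : k ≤ s.length)
    (hs : s.take k ∈ B) (hM : ∀ s ∈ B, c ≤ M s) : c ≤ stopped B M s := by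
  have h : ∃ k, k ≤ s.length ∧ s.take k ∈ B := ⟨k, hk, hs⟩
  unfold stopped
  rw [dif_pos h]
  classical
  exact hM _ (by convert (Nat.find_spec h).2)

theorem stopped_append_of_take_mem {s : Situation} (h : ∃ k, k ≤ s.length ∧ s.take k ∈ B)
    (x : Bool) : stopped B M (s ++ [x]) = stopped B M s := by
  classical
  have h' : ∃ k, k ≤ (s ++ [x]).length ∧ (s ++ [x]).take k ∈ B := by
    obtain ⟨k, hk, hs⟩ := h
    exact ⟨k, by simp; omega, by rwa [List.take_append_of_le_length hk]⟩
  have hfind : Nat.find h' = Nat.find h := by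
    have hs := Nat.find_spec h
    refine (Nat.find_eq_iff h').2 ⟨⟨hs.1.trans (by simp), ?_⟩, fun n hn hn' => ?_⟩
    · rw [List.take_append_of_le_length hs.1]; exact hs.2
    · refine Nat.find_min h hn ⟨hn.le.trans hs.1, ?_⟩
      rw [← List.take_append_of_le_length (l₂ := [x]) (hn.le.trans hs.1)]
      exact hn'.2
  unfold stopped
  rw [dif_pos h, dif_pos h']
  congr 1
  have := (Nat.find_spec h).1
  rw [hfind]
  exact List.take_append_of_le_length this

theorem stopped_append_of_take_notMem {s : Situation}
    (h : ¬∃ k, k ≤ s.length ∧ s.take k ∈ B) (x : Bool) :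
    stopped B M (s ++ [x]) = M (s ++ [x]) := by
  classical
  unfold stopped
  split_ifs with h'
  · have hs := Nat.find_spec h'
    congr 1
    have hlt : s.length < Nat.find h' := by
      by_contra! hle
      exact h ⟨_, hle, by rw [← List.take_append_of_le_length (l₂ := [x]) hle]; exact hs.2⟩
    have hlen : (s ++ [x]).length = s.length + 1 := by simp
    exact List.take_of_length_le (hlen.trans_le hlt)
  · rfl

/-- Before the visit to `B` the stopped process moves like `M`; afterwards it is constant. -/
theorem IsSupermartingale.stopped {φ : ForecastingSystem} (hM : IsSupermartingale φ M) :
    IsSupermartingale φ (stopped B M) := by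
  rw [isSupermartingale_iff] at *
  intro s p hp
  by_cases h : ∃ k, k ≤ s.length ∧ s.take k ∈ B
  · rw [stopped_append_of_take_mem h, stopped_append_of_take_mem h]
    linarith
  · rw [stopped_append_of_take_notMem h, stopped_append_of_take_notMem h]
    simpa [Forecasting.stopped, h] using hM s p hp

end Stopped

/-- Ville's inequality. -/
theorem upperProb_le_of_subset_cylSet {φ : ForecastingSystem} {T : Situation → ℝ}
    (hT : IsTestSupermartingale φ T) {G : Set Path} {B : Set Situation} (hG : G ⊆ cylSet B)
    {c : ℝ} (hc : 0 < c) (hB : ∀ s ∈ B, c ≤ T s) : upperProb φ G ≤ ((c⁻¹ : ℝ) : EReal) := by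
  have h : Superhedges φ G fun s => c⁻¹ * stopped B T s := by
    refine ⟨hT.1.stopped.const_mul (inv_nonneg.2 hc.le), fun ω => ?_⟩
    by_cases hω : ω ∈ G
    · obtain ⟨n, hn⟩ := mem_cylSet_iff.1 (hG hω)
      refine Filter.le_liminf_of_le (by isBoundedDefault) ?_
      filter_upwards [Filter.eventually_ge_atTop n] with m hm
      have h1 : c ≤ stopped B T (ω.upTo m) :=
        le_stopped_of_take_mem (k := n) (by simpa) (by rwa [Path.take_upTo, min_eq_left hm]) hB
      have h2 : 1 ≤ c⁻¹ * stopped B T (ω.upTo m) := by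
        rw [← inv_mul_cancel₀ hc.ne']
        exact mul_le_mul_of_nonneg_left h1 (inv_nonneg.2 hc.le)
      simpa [hω] using! (EReal.coe_le_coe_iff.2 h2)
    · refine Filter.le_liminf_of_le (by isBoundedDefault) (Filter.Eventually.of_forall fun m => ?_)
      have h2 : 0 ≤ c⁻¹ * stopped B T (ω.upTo m) :=
        mul_nonneg (inv_nonneg.2 hc.le) (le_stopped hT.2.1)
      simpa [hω] using! (EReal.coe_le_coe_iff.2 h2)
  simpa [stopped_nil, hT.2.2] using h.upperProb_le

/-! ### Schnorr test randomness implies Schnorr randomness -/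

theorem LowerSemicomputable.exists_approx {D : Type*} [Primcodable D] {r : D → ℝ}
    (hr : LowerSemicomputable r) : ∃ q : D × ℕ → ℚ, RecursiveRat q ∧
      (∀ d n, (q (d, n) : ℝ) ≤ r d) ∧
      ∀ d, Filter.Tendsto (fun n => (q (d, n) : ℝ)) Filter.atTop (nhds (r d)) := by
  obtain ⟨q, hq, hmono, hlim⟩ := hr
  refine ⟨q, hq, fun d n => ?_, hlim⟩
  have h : Monotone fun n => (q (d, n) : ℝ) :=
    monotone_nat_of_le_succ fun n => by exact_mod_cast hmono d n
  exact h.ge_of_tendsto (hlim d) n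

/-- With approximations `q ≤ r` and `q' ≤ -r` from below, search for a stage where `q + q' ≥ -1`;
then `r ≤ -q' ≤ q + 1`. -/
theorem ComputableReal.exists_rational_approx {D : Type*} [Primcodable D] {r : D → ℝ}
    (hr : ComputableReal r) :
    ∃ q : D → ℚ, RecursiveRat q ∧ ∀ d, (q d : ℝ) ≤ r d ∧ r d ≤ q d + 1 := by
  obtain ⟨q, hq, hle, hlim⟩ := hr.1.exists_approx
  obtain ⟨q', hq', hle', hlim'⟩ := hr.2.exists_approx
  have hcomp : ComputablePred fun x : D × ℕ => (-1 : ℚ) ≤ q x + q' x :=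
    ((recursiveRat_natCast (Computable.const 1)).neg.computablePred_le (hq.add hq')).of_eq
      fun x => by simp
  obtain ⟨n, hn, hspec⟩ := exists_computable_choice
    (p := fun d n => (-1 : ℚ) ≤ q (d, n) + q' (d, n)) hcomp fun d => by
      have h := (hlim d).add (hlim' d)
      rw [add_neg_cancel] at h
      obtain ⟨n, hn⟩ := (h.eventually_const_lt (by norm_num : (-1 : ℝ) < 0)).exists
      exact ⟨n, by exact_mod_cast hn.le⟩
  refine ⟨_, hq.comp (Computable.id.pair hn), fun d => ⟨hle d (n d), ?_⟩⟩
  have h1 : (-1 : ℝ) ≤ q (d, n d) + q' (d, n d) := by exact_mod_cast hspec d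
  have h2 := hle' d (n d)
  simp only [id]
  linarith

theorem ComputablyUnbounded.frequently_lt {μ : ℕ → ℝ} {ρ : ℕ → ℕ}
    (h : 0 < Filter.limsup (fun n => ((μ n - (ρ n : ℝ) : ℝ) : EReal)) Filter.atTop) :
    ∃ᶠ n in Filter.atTop, (ρ n : ℝ) < μ n := by
  refine (Filter.frequently_lt_of_lt_limsup (by isBoundedDefault) h).mono fun n hn => ?_
  have : 0 < μ n - ρ n := by exact_mod_cast hn
  linarith

theorem IsGrowthFunction.exists_ge {ρ : ℕ → ℕ} (hρ : IsGrowthFunction ρ) (N : ℕ) :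
    ∃ n, N ≤ ρ n := by
  by_contra! h
  exact hρ.2.2 ⟨N, by rintro _ ⟨n, rfl⟩; exact (h n).le⟩

theorem SchnorrTestRandom.schnorrRandom {φ : ForecastingSystem} {ω : Path}
    (h : SchnorrTestRandom φ ω) : SchnorrRandom φ ω := by
  rintro T hT hTc ⟨ρ, hρ, hlim⟩
  obtain ⟨q, hq, hqT⟩ := hTc.exists_rational_approx
  -- The slack of one in `2 ^ n + 1` absorbs the approximation error, so that `T` is at least `2 ^
  -- n` on the `n`-th section.
  let A : Set (ℕ × Situation) :=
    {p | 2 ^ p.1 + 1 ≤ ρ p.2.length ∧ (ρ p.2.length : ℚ) < q p.2 + (1 : ℕ)}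
  have hA : ComputablePred fun p => p ∈ A := by
    have hρ' : Computable fun p : ℕ × Situation => ρ p.2.length :=
      hρ.1.comp (Computable.list_length.comp Computable.snd)
    exact computablePred_and
      (computablePred_nat_le (computable_nat_add
        (computable_nat_pow (Computable.const 2) Computable.fst) (Computable.const 1)) hρ')
      ((recursiveRat_natCast hρ').computablePred_lt
        ((hq.comp Computable.snd).add (recursiveRat_natCast (Computable.const 1))))
  have hAT : ∀ n, ∀ s ∈ sec A n, ∀ N, 2 ^ N + 1 ≤ ρ s.length → (2 : ℝ) ^ N ≤ T s := by
    rintro n s ⟨-, hs⟩ N hN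
    have h1 : (ρ s.length : ℝ) < q s + 1 := by exact_mod_cast hs
    have h2 : (2 : ℝ) ^ N + 1 ≤ ρ s.length := by exact_mod_cast hN
    linarith [(hqT s).1]
  obtain ⟨e, he, hespec⟩ := exists_computable_choice
    (p := fun (N : ℕ) ℓ => 2 ^ N + 1 ≤ ρ ℓ)
    (computablePred_nat_le (computable_nat_add
      (computable_nat_pow (Computable.const 2) Computable.fst) (Computable.const 1))
      (hρ.1.comp Computable.snd)) fun N => hρ.exists_ge _
  refine h (fun n => cylSet (sec A n)) ⟨A, hA, fun _ => rfl, fun n => ?_,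
    fun p => e p.1, he.comp Computable.fst, fun N n ℓ hℓ => ?_⟩ ?_
  · rw [one_div, inv_pow]
    exact upperProb_le_of_subset_cylSet hT subset_rfl (by positivity)
      fun s hs => hAT n s hs n hs.1
  · rw [one_div, inv_pow]
    -- A path in the tail visits the section only at depths at least `ℓ`, where `ρ` already exceeds
    -- `2 ^ N`.
    refine upperProb_le_of_subset_cylSet (B := {s ∈ sec A n | ℓ ≤ s.length}) hT ?_
      (by positivity) fun s hs => hAT n s hs.1 N ((hespec N).trans (hρ.2.1 (hℓ.trans hs.2)))
    rintro ω ⟨h1, h2⟩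
    obtain ⟨k, hk⟩ := mem_cylSet_iff.1 h1
    refine mem_cylSet_iff.2 ⟨k, hk, ?_⟩
    by_contra hlt
    exact h2 (mem_cylSet_iff.2 ⟨k, hk, not_le.1 hlt⟩)
  · refine Set.mem_iInter.2 fun n => mem_cylSet_iff.2 ?_
    obtain ⟨k, hk⟩ := hρ.exists_ge (2 ^ n + 1)
    obtain ⟨m, hm, hkm⟩ :=
      ((ComputablyUnbounded.frequently_lt hlim).and_eventually
        (Filter.eventually_ge_atTop k)).exists
    refine ⟨m, ?_, ?_⟩
    · simpa using hk.trans (hρ.2.1 hkm)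
    · have h1 := hm.trans_le (hqT (ω.upTo m)).2
      simp only [Path.length_upTo]
      exact_mod_cast h1

/-! ### Backward induction -/

/-- The value in `s`, by backward induction over `h` steps, of the terminal gain `g`, when the
forecast in the situation `t` is the interval `[lo t, up t]`. -/
noncomputable def value (lo up g : Situation → ℝ) : ℕ → Situation → ℝ :=
  treeRec g (· ++ [true]) (· ++ [false]) fun s a b =>
    max (lo s * a + (1 - lo s) * b) (up s * a + (1 - up s) * b)

section Value

variable {φ : ForecastingSystem} {lo up g : Situation → ℝ}

theorem value_zero (s : Situation) : value lo up g 0 s = g s := rfl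

theorem value_succ (h : ℕ) (s : Situation) : value lo up g (h + 1) s =
    max (lo s * value lo up g h (s ++ [true]) + (1 - lo s) * value lo up g h (s ++ [false]))
      (up s * value lo up g h (s ++ [true]) + (1 - up s) * value lo up g h (s ++ [false])) :=
  rfl

/-- Backward induction yields the least capital that secures the gain: the weights `p` and `1 - p`
are non-negative, so domination passes from the children to `s`. -/
theorem value_le {M : Situation → ℝ} (hM : IsSupermartingale φ M) {L : ℕ}
    (hg : ∀ s, L ≤ s.length → g s ≤ M s) (h : ℕ) (s : Situation) (hs : L ≤ s.length + h) :
    value (fun s => (φ s).lower) (fun s => (φ s).upper) g h s ≤ M s := by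
  induction h generalizing s with
  | zero => exact hg s hs
  | succ h ih =>
    have h1 := ih (s ++ [true]) (by simp; omega)
    have h0 := ih (s ++ [false]) (by simp; omega)
    have key : ∀ p ∈ Set.Icc (φ s).lower (φ s).upper,
        p * value (fun s => (φ s).lower) (fun s => (φ s).upper) g h (s ++ [true]) +
          (1 - p) * value (fun s => (φ s).lower) (fun s => (φ s).upper) g h (s ++ [false]) ≤
        M s := fun p hp => by
      refine le_trans ?_ (isSupermartingale_iff.1 hM s p hp)
      have hp0 : 0 ≤ p := (φ s).lower_nonneg.trans hp.1
      have hp1 : 0 ≤ 1 - p := sub_nonneg.2 (hp.2.trans (φ s).upper_le_one)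
      gcongr
    rw [value_succ]
    exact max_le (key _ ⟨le_rfl, (φ s).lower_le_upper⟩) (key _ ⟨(φ s).lower_le_upper, le_rfl⟩)

theorem tendsto_value {lo' up' : ℕ → Situation → ℝ}
    (hlo : ∀ s, Filter.Tendsto (fun m => lo' m s) Filter.atTop (nhds (lo s)))
    (hup : ∀ s, Filter.Tendsto (fun m => up' m s) Filter.atTop (nhds (up s)))
    (h : ℕ) (s : Situation) :
    Filter.Tendsto (fun m => value (lo' m) (up' m) g h s) Filter.atTop
      (nhds (value lo up g h s)) := by
  induction h generalizing s with
  | zero => exact tendsto_const_nhds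
  | succ h ih =>
    simp only [value_succ]
    exact ((((hlo s).mul (ih _)).add (((hlo s).const_sub 1).mul (ih _))).max
      (((hup s).mul (ih _)).add (((hup s).const_sub 1).mul (ih _))))

theorem value_eq_one {L : ℕ} {s : Situation}
    (hg : ∀ t, L ≤ (s ++ t).length → g (s ++ t) = 1) (h : ℕ) (hs : L ≤ s.length + h) :
    value lo up g h s = 1 := by
  induction h generalizing s with
  | zero => simpa [value_zero] using hg [] (by simpa using hs)
  | succ h ih =>
    have key : ∀ x, value lo up g h (s ++ [x]) = 1 := fun x =>
      ih (fun t => by simpa using hg (x :: t)) (by simp; omega)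
    rw [value_succ, key, key]
    simp

/-- The local expectation is affine in `p`, so its maximum over the larger interval `[lo s, up s]`
is at an endpoint. From depth `L` on no steps remain and the gain is frozen. -/
theorem isSupermartingale_value (hlo : ∀ s, lo s ≤ (φ s).lower) (hup : ∀ s, (φ s).upper ≤ up s)
    {L : ℕ} (hg : ∀ s x, L ≤ s.length → g (s ++ [x]) = g s) :
    IsSupermartingale φ fun s => value lo up g (L - s.length) s := by
  rw [isSupermartingale_iff]
  intro s p hp
  rcases le_or_gt L s.length with hs | hs
  · have hx : ∀ x : Bool, L - (s ++ [x]).length = 0 := fun x => by simp; omega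
    simp only [hx, Nat.sub_eq_zero_of_le hs, value_zero, hg s _ hs]
    linarith
  · obtain ⟨h, hh⟩ := Nat.exists_eq_add_of_lt hs
    have h0 : L - s.length = h + 1 := by omega
    have hx : ∀ x : Bool, L - (s ++ [x]).length = h := fun x => by simp; omega
    simp only [hx, h0, value_succ]
    set a := value lo up g h (s ++ [true])
    set b := value lo up g h (s ++ [false])
    rcases le_total b a with hab | hab
    · refine le_max_of_le_right ?_
      nlinarith [mul_nonneg (sub_nonneg.2 (hp.2.trans (hup s))) (sub_nonneg.2 hab)]
    · refine le_max_of_le_left ?_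
      nlinarith [mul_nonneg (sub_nonneg.2 ((hlo s).trans hp.1)) (sub_nonneg.2 hab)]

end Value

/-! ### Computable consequences of the assumptions on the forecasting system -/

/-- Approximating from outside ensures that a supermartingale for the rational forecasts is one for
`φ`. Clipping to the unit interval keeps these inclusions and the limits, and makes `Frac.compl`
exact. -/
theorem ComputableSystem.exists_outer_approx {φ : ForecastingSystem} (hφ : ComputableSystem φ) :
    ∃ P : Situation × ℕ → Frac × Frac, Computable P ∧
      (∀ s m, ((P (s, m)).1.val : ℝ) ≤ (φ s).lower ∧ (φ s).upper ≤ ((P (s, m)).2.val : ℝ)) ∧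
      (∀ x, (P x).1.val ≤ 1 ∧ (P x).2.val ≤ 1) ∧
      (∀ s, Filter.Tendsto (fun m => ((P (s, m)).1.val : ℝ)) Filter.atTop
        (nhds (φ s).lower)) ∧
      ∀ s, Filter.Tendsto (fun m => ((P (s, m)).2.val : ℝ)) Filter.atTop
        (nhds (φ s).upper) := by
  obtain ⟨q, hq, hle, hlim⟩ := hφ.1.1.exists_approx
  obtain ⟨q', hq', hle', hlim'⟩ := hφ.2.2.exists_approx
  obtain ⟨f, hf, hfv⟩ := Frac.exists_computable_clip hq
  obtain ⟨f', hf', hfv'⟩ := Frac.exists_computable_clip hq'.neg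
  have h0 := fun s => (φ s).lower_nonneg
  have h1 := fun s => (φ s).lower_le_upper
  have h2 := fun s => (φ s).upper_le_one
  refine ⟨fun x => (f x, f' x), hf.pair hf', fun s m => ⟨?_, ?_⟩, fun x => ⟨?_, ?_⟩,
    fun s => ?_, fun s => ?_⟩
  · simp only [hfv]
    push_cast
    exact max_le (h0 s) ((min_le_right _ _).trans (hle s m))
  · simp only [hfv']
    push_cast
    exact le_max_of_le_right (le_min (h2 s) (by linarith [hle' s m]))
  · simp only [hfv]
    exact max_le zero_le_one (min_le_left _ _)
  · simp only [hfv']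
    exact max_le zero_le_one (min_le_left _ _)
  · have h := (tendsto_const_nhds (x := (0 : ℝ))).max
      ((tendsto_const_nhds (x := (1 : ℝ))).min (hlim s))
    rw [min_eq_right ((h1 s).trans (h2 s)), max_eq_right (h0 s)] at h
    refine h.congr fun m => ?_
    simp only [hfv]
    push_cast
    rfl
  · have h := (tendsto_const_nhds (x := (0 : ℝ))).max
      ((tendsto_const_nhds (x := (1 : ℝ))).min (hlim' s).neg)
    rw [neg_neg, min_eq_right (h2 s), max_eq_right ((h0 s).trans (h1 s))] at h
    refine h.congr fun m => ?_
    simp only [hfv']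
    push_cast
    rfl

/-- Search for `m` such that `1 / (m + 1)` is below the lower approximations of `upper` and `1 -
lower`; both limits are positive by non-degeneracy, so the search ends. -/
theorem ComputableSystem.exists_growth_bound {φ : ForecastingSystem} (hφ : ComputableSystem φ)
    (hnd : NonDegenerate φ) : ∃ c : Situation → ℕ, Computable c ∧
      ∀ s, 1 ≤ ((c s : ℝ) + 1) * (φ s).upper ∧ 1 ≤ ((c s : ℝ) + 1) * (1 - (φ s).lower) := by
  obtain ⟨q, hq, hle, hlim⟩ := hφ.2.1.exists_approx
  obtain ⟨q', hq', hle', hlim'⟩ := hφ.1.2.exists_approx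
  have hdiv : RecursiveRat fun x : Situation × ℕ => ((1 : ℕ) : ℚ) / ((x.2 : ℚ) + 1) :=
    recursiveRat_div_succ (Computable.const 1) Computable.snd
  have hone : RecursiveRat fun _ : Situation × ℕ => ((1 : ℕ) : ℚ) :=
    recursiveRat_natCast (Computable.const 1)
  obtain ⟨c, hc, hspec⟩ := exists_computable_choice
    (p := fun s m => ((1 : ℕ) : ℚ) / ((m : ℚ) + 1) ≤ q (s, m) ∧
      ((1 : ℕ) : ℚ) / ((m : ℚ) + 1) ≤ ((1 : ℕ) : ℚ) + q' (s, m))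
    (computablePred_and (hdiv.computablePred_le hq) (hdiv.computablePred_le (hone.add hq')))
    fun s => by
      have h0 := tendsto_one_div_add_atTop_nhds_zero_nat (𝕜 := ℝ)
      have h1 := h0.eventually_lt (hlim s) (hnd s).2
      have h2 := h0.eventually_lt ((hlim' s).const_add 1) (by linarith [(hnd s).1])
      obtain ⟨m, hm1, hm2⟩ := (h1.and h2).exists
      refine ⟨m, ?_, ?_⟩
      · have : ((((1 : ℕ) : ℚ) / ((m : ℚ) + 1) : ℚ) : ℝ) ≤ (q (s, m) : ℝ) := by
          push_cast; exact hm1.le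
        exact_mod_cast this
      · have : ((((1 : ℕ) : ℚ) / ((m : ℚ) + 1) : ℚ) : ℝ) ≤
            ((((1 : ℕ) : ℚ) + q' (s, m) : ℚ) : ℝ) := by
          push_cast; exact hm2.le
        exact_mod_cast this
  refine ⟨c, hc, fun s => ?_⟩
  have hpos : (0 : ℝ) < (c s : ℝ) + 1 := by positivity
  have key : ∀ x : ℝ, 1 / ((c s : ℝ) + 1) ≤ x → 1 ≤ ((c s : ℝ) + 1) * x := fun x hx => by
    rwa [div_le_iff₀' hpos] at hx
  obtain ⟨h1, h2⟩ := hspec s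
  have h1' : 1 / ((c s : ℝ) + 1) ≤ q (s, c s) := by
    simpa using (Rat.cast_le (K := ℝ)).2 h1
  have h2' : 1 / ((c s : ℝ) + 1) ≤ 1 + q' (s, c s) := by
    simpa using (Rat.cast_le (K := ℝ)).2 h2
  exact ⟨key _ (h1'.trans (hle _ _)), key _ (h2'.trans (by linarith [hle' s (c s)]))⟩

/-- Dropping the other non-negative term from the supermartingale inequality at an endpoint of the
forecast bounds one step by the factor `c u + 1`. The bound multiplies these factors along the
situation; those contributed by `s` itself are at least one and do no harm. -/
theorem exists_supermartingale_bound {φ : ForecastingSystem} (hφ : ComputableSystem φ)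
    (hnd : NonDegenerate φ) : ∃ C : Situation → ℕ, Computable C ∧
      ∀ M : Situation → ℝ, IsSupermartingale φ M → (∀ s, 0 ≤ M s) → ∀ s t,
        M (s ++ t) ≤ C (s ++ t) * M s := by
  obtain ⟨c, hc, hspec⟩ := hφ.exists_growth_bound hnd
  refine ⟨fun s => ∏ k ∈ Finset.range s.length, (c (s.take k) + 1),
    computable_prod_range (Computable.succ.comp (hc.comp
      (Primrec.list_take.to_comp.comp Computable.snd Computable.fst))) Computable.list_length,
    fun M hM hM0 s t => ?_⟩
  induction t using List.reverseRecOn with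
  | nil =>
    rw [List.append_nil]
    refine le_mul_of_one_le_left (hM0 s) ?_
    exact_mod_cast Finset.prod_pos fun k _ => Nat.succ_pos _
  | append_singleton t x ih =>
    rw [← List.append_assoc]
    set u := s ++ t
    have hlen : (u ++ [x]).length = u.length + 1 := by simp
    have hprod : ∏ k ∈ Finset.range (u ++ [x]).length, (c ((u ++ [x]).take k) + 1) =
        (∏ k ∈ Finset.range u.length, (c (u.take k) + 1)) * (c u + 1) := by
      rw [hlen, Finset.prod_range_succ]
      congr 1
      · refine Finset.prod_congr rfl fun k hk => ?_
        rw [List.take_append_of_le_length (Finset.mem_range.1 hk).le]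
      · simp
    have hstep : M (u ++ [x]) ≤ (c u + 1) * M u := by
      have hpos : (0 : ℝ) ≤ (c u : ℝ) + 1 := by positivity
      have h0 := (φ u).lower_nonneg
      have h1 := (φ u).lower_le_upper
      have h2 := (φ u).upper_le_one
      have key : ∀ p y : ℝ, 1 ≤ ((c u : ℝ) + 1) * p → 0 ≤ y → p * y ≤ M u →
          y ≤ (c u + 1) * M u := fun p y hp hy hpy => by
        calc y ≤ ((c u + 1) * p) * y := le_mul_of_one_le_left hy hp
          _ = (c u + 1) * (p * y) := by ring
          _ ≤ _ := mul_le_mul_of_nonneg_left hpy hpos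
      cases x
      · refine key _ _ (hspec u).2 (hM0 _) ?_
        have := isSupermartingale_iff.1 hM u _ ⟨le_rfl, h1⟩
        linarith [mul_nonneg h0 (hM0 (u ++ [true]))]
      · refine key _ _ (hspec u).1 (hM0 _) ?_
        have := isSupermartingale_iff.1 hM u _ ⟨h1, le_rfl⟩
        linarith [mul_nonneg (sub_nonneg.2 h2) (hM0 (u ++ [false]))]
    simp only [hprod]
    push_cast
    have hpos : (0 : ℝ) ≤ (c u : ℝ) + 1 := by positivity
    refine hstep.trans ((mul_le_mul_of_nonneg_left ih hpos).trans_eq ?_)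
    push_cast
    ring

/-! ### Computable supermartingales for blocks of a test -/

open Classical in
/-- The terminal gain that is one if the first visit to `S` has depth in `[ℓ, L)`. -/
noncomputable def blockGain (S : Set Situation) (ℓ L : ℕ) (s : Situation) : ℝ :=
  if (∃ k < L, s.take k ∈ S) ∧ ¬∃ k < ℓ, s.take k ∈ S then 1 else 0

section BlockGain

variable {S : Set Situation} {ℓ L : ℕ}

theorem blockGain_append (hℓ : ℓ ≤ L) {s : Situation} (hs : L ≤ s.length) (x : Bool) :
    blockGain S ℓ L (s ++ [x]) = blockGain S ℓ L s := by
  have h : ∀ N ≤ L, (∃ k < N, (s ++ [x]).take k ∈ S) ↔ ∃ k < N, s.take k ∈ S := fun N hN => by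
    refine exists_congr fun k => and_congr_right fun hk => ?_
    rw [List.take_append_of_le_length (by omega)]
  classical
  exact if_congr (and_congr (h L le_rfl) (not_congr (h ℓ hℓ))) rfl rfl

/-- Beyond depth `L` the gain is decided: if it is one, the whole cylinder lies in the event, so a
superhedge has capital at least one there. -/
theorem blockGain_le (hℓ : ℓ ≤ L) {φ : ForecastingSystem} {M : Situation → ℝ}
    (hM : Superhedges φ (cylSet (S ∩ {t | t.length < L}) \ cylSet (S ∩ {t | t.length < ℓ})) M)
    {s : Situation} (hs : L ≤ s.length) : blockGain S ℓ L s ≤ M s := by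
  unfold blockGain
  split_ifs with h
  · refine hM.one_le fun ω hω => ?_
    rw [mem_cyl_iff] at hω
    obtain ⟨⟨k, hk, hkS⟩, h2⟩ := h
    have htake : ∀ n < L, s.take n = ω.upTo n := fun n hn => by
      rw [← hω, Path.take_upTo, min_eq_left (by omega)]
    refine ⟨mem_cylSet_iff.2 ⟨k, by rwa [← htake k hk], by simpa using hk⟩, fun hn => ?_⟩
    obtain ⟨n, hnS, hn⟩ := mem_cylSet_iff.1 hn
    have hn' : n < ℓ := by simpa using hn
    exact h2 ⟨n, hn', by rwa [htake n (by omega)]⟩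
  · exact hM.nonneg s

theorem blockGain_append_eq_one {s : Situation} {k : ℕ} (hk : k ≤ s.length) (hkL : k < L)
    (hkS : s.take k ∈ S) (hS : ∀ n < ℓ, s.take n ∉ S) (t : Situation) :
    blockGain S ℓ L (s ++ t) = 1 := by
  have hℓk : ℓ ≤ k := not_lt.1 fun h => hS k h hkS
  refine if_pos ⟨⟨k, hkL, by rwa [List.take_append_of_le_length hk]⟩, ?_⟩
  rintro ⟨n, hn, hnS⟩
  rw [List.take_append_of_le_length (by omega)] at hnS
  exact hS n hn hnS

end BlockGain

theorem Frac.val_mul_le_one_iff (x : Frac) (N : ℕ) : x.val * N ≤ 1 ↔ x.1 * N ≤ x.2 + 1 := by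
  have h : (0 : ℚ) < (x.2 : ℚ) + 1 := by positivity
  rw [Frac.val, div_mul_eq_mul_div, div_le_one h]
  exact_mod_cast Iff.rfl

/-- Backward induction for the gains `blockGain` can be performed in rational arithmetic, for
outer approximations of the forecasts. -/
theorem ComputableSystem.exists_computable_value {φ : ForecastingSystem}
    (hφ : ComputableSystem φ) {A : Set (ℕ × Situation)} (hA : ComputablePred fun p => p ∈ A)
    {ℓ L : ℕ → ℕ} (hℓ : Computable ℓ) (hL : Computable L) :
    ∃ V : (ℕ × ℕ) × Situation → Frac, Computable V ∧
      ∃ lo up : ℕ → Situation → ℝ,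
        (∀ i m s, ((V ((i, m), s)).val : ℝ) =
          value (lo m) (up m) (blockGain (sec A i) (ℓ i) (L i)) (L i - s.length) s) ∧
        (∀ m s, lo m s ≤ (φ s).lower ∧ (φ s).upper ≤ up m s) ∧
        (∀ s, Filter.Tendsto (fun m => lo m s) Filter.atTop (nhds (φ s).lower)) ∧
        ∀ s, Filter.Tendsto (fun m => up m s) Filter.atTop (nhds (φ s).upper) := by
  classical
  obtain ⟨P, hP, hbounds, hone, hlo, hup⟩ := hφ.exists_outer_approx
  have hvisit : ∀ {N : ℕ → ℕ}, Computable N → ComputablePred fun x : (ℕ × ℕ) × Situation =>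
      ∃ k < N x.1.1, x.2.take k ∈ sec A x.1.1 := fun {N} hN => by
    have hi : Computable fun x : (ℕ × ℕ) × Situation => x.1.1 :=
      Computable.fst.comp Computable.fst
    refine computablePred_exists_lt (p := fun (x : (ℕ × ℕ) × Situation) k =>
      x.2.take k ∈ sec A x.1.1) ?_ (hN.comp hi)
    exact computablePred_comp hA ((hi.comp Computable.fst).pair
      (Primrec.list_take.to_comp.comp Computable.snd (Computable.snd.comp Computable.fst)))
  let base : (ℕ × ℕ) × Situation → Frac := fun x =>
    if (∃ k < L x.1.1, x.2.take k ∈ sec A x.1.1) ∧ ¬∃ k < ℓ x.1.1, x.2.take k ∈ sec A x.1.1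
    then (1, 0) else (0, 0)
  have hbase : Computable base :=
    computable_ite (computablePred_and (hvisit hL) (hvisit hℓ).not)
      (Computable.const _) (Computable.const _)
  -- The block index and the precision `m` are carried unchanged through the tree.
  let child (b : Bool) : (ℕ × ℕ) × Situation → (ℕ × ℕ) × Situation :=
    fun x => (x.1, x.2 ++ [b])
  have hchild : ∀ b, Computable (child b) := fun b =>
    Computable.fst.pair (Computable.list_append.comp Computable.snd (Computable.const [b]))
  let step : (ℕ × ℕ) × Situation → Frac → Frac → Frac := fun x a b =>
    Frac.upperExp (P (x.2, x.1.2)) a b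
  have hstep : Computable fun p : ((ℕ × ℕ) × Situation) × Frac × Frac =>
      step p.1 p.2.1 p.2.2 :=
    Frac.computable_upperExp (hP.comp ((Computable.snd.comp Computable.fst).pair
      (Computable.snd.comp (Computable.fst.comp Computable.fst))))
      (Computable.fst.comp Computable.snd) (Computable.snd.comp Computable.snd)
  have hrec := computable_treeRec hbase (hchild true) (hchild false) hstep
  have hdepth : Computable fun x : (ℕ × ℕ) × Situation => (L x.1.1 - x.2.length, x) :=
    (computable_nat_sub (hL.comp (Computable.fst.comp Computable.fst))
      (Computable.list_length.comp Computable.snd)).pair Computable.id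
  have hV := Computable.comp hrec hdepth
  refine ⟨fun x => treeRec base (child true) (child false) step (L x.1.1 - x.2.length) x, hV,
    fun m s => ((P (s, m)).1.val : ℝ), fun m s => ((P (s, m)).2.val : ℝ), ?_,
    fun m s => hbounds s m, hlo, hup⟩
  intro i m s
  dsimp only
  generalize L i - s.length = h
  induction h generalizing s with
  | zero =>
    change (((if _ then _ else _ : Frac).val : ℚ) : ℝ) = blockGain _ _ _ s
    unfold blockGain
    split_ifs <;> simp
  | succ h ih =>
    rw [value_succ, ← ih, ← ih]
    change (((Frac.upperExp (P (s, m)) (treeRec base (child true) (child false) step h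
      ((i, m), s ++ [true])) (treeRec base (child true) (child false) step h
      ((i, m), s ++ [false]))).val : ℚ) : ℝ) = _
    simp [Frac.upperExp, Frac.val_compl (hone _).1, Frac.val_compl (hone _).2]

/-- The exact backward value at the root is at most the upper probability of the block event, and
the values for outer approximations converge to it. The factor two between `K i + 1` and `K i`
leaves room for a rational approximation. -/
theorem ComputableSystem.exists_computable_supermartingale {φ : ForecastingSystem}
    (hφ : ComputableSystem φ) {A : Set (ℕ × Situation)} (hA : ComputablePred fun p => p ∈ A)
    {ℓ L K : ℕ → ℕ} (hℓ : Computable ℓ) (hL : Computable L) (hK : Computable K)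
    (hℓL : ∀ i, ℓ i ≤ L i)
    (hprob : ∀ i, upperProb φ (cylSet (secLT A i (L i)) \ cylSet (secLT A i (ℓ i))) ≤
      (((1 / 2 : ℝ) ^ (K i + 1) : ℝ) : EReal)) :
    ∃ F : Situation × ℕ → Frac, Computable F ∧ ∀ i,
      IsSupermartingale φ (fun s => ((F (s, i)).val : ℝ)) ∧
      (F ([], i)).val * (2 ^ K i : ℕ) ≤ 1 ∧
      ∀ s k, k ≤ s.length → k < L i → s.take k ∈ sec A i →
        (∀ n < ℓ i, s.take n ∉ sec A i) → (F (s, i)).val = 1 := by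
  obtain ⟨V, hV, lo, up, hVal, hbounds, hlo, hup⟩ := hφ.exists_computable_value hA hℓ hL
  have hlimit : ∀ i, value (fun s => (φ s).lower) (fun s => (φ s).upper)
      (blockGain (sec A i) (ℓ i) (L i)) (L i) [] ≤ (1 / 2 : ℝ) ^ (K i + 1) := fun i => by
    have h := (le_upperProb fun M hM => value_le hM.1
      (fun s hs => blockGain_le (S := sec A i) (hℓL i) hM hs) (L i) [] (by simp)).trans (hprob i)
    exact_mod_cast h
  have hV0 : Computable fun x : ℕ × ℕ => V (x, []) :=
    hV.comp (Computable.id.pair (Computable.const []))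
  -- One precision `m` per block is found by checking the rational value at the root.
  obtain ⟨m, hm, hspec⟩ := exists_computable_choice
    (p := fun i m => (V ((i, m), [])).1 * 2 ^ K i ≤ (V ((i, m), [])).2 + 1)
    (computablePred_nat_le (computable_nat_mul (Computable.fst.comp hV0)
      (computable_nat_pow (Computable.const 2) (hK.comp Computable.fst)))
      (Computable.succ.comp (Computable.snd.comp hV0))) fun i => by
    have h1 := tendsto_value (g := blockGain (sec A i) (ℓ i) (L i)) hlo hup (L i) []
    have h2 : (1 / 2 : ℝ) ^ (K i + 1) < (1 / 2 : ℝ) ^ K i :=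
      pow_lt_pow_right_of_lt_one₀ (by norm_num) (by norm_num) (Nat.lt_succ_self _)
    obtain ⟨m, hm⟩ := (h1.eventually_lt_const ((hlimit i).trans_lt h2)).exists
    refine ⟨m, (Frac.val_mul_le_one_iff _ _).1 ?_⟩
    have h3 : ((V ((i, m), [])).val : ℝ) < (1 / 2 : ℝ) ^ K i := by
      rw [hVal]
      exact hm
    have h4 : ((V ((i, m), [])).val : ℝ) * 2 ^ K i ≤ 1 := by
      rw [one_div, inv_pow, ← one_div, lt_div_iff₀ (by positivity)] at h3
      exact h3.le
    exact_mod_cast h4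
  refine ⟨fun x => V ((x.2, m x.2), x.1),
    hV.comp ((Computable.snd.pair (hm.comp Computable.snd)).pair Computable.fst),
    fun i => ⟨?_, (Frac.val_mul_le_one_iff _ _).2 (hspec i), fun s k hk hkL hkS hS => ?_⟩⟩
  · simp only [hVal]
    exact isSupermartingale_value (fun s => (hbounds _ s).1) (fun s => (hbounds _ s).2)
      fun s x hs => blockGain_append (hℓL i) hs x
  · have h : ((V ((i, m i), s)).val : ℝ) = 1 := by
      rw [hVal]
      exact value_eq_one (L := L i) (fun t _ => blockGain_append_eq_one hk hkL hkS hS t) _ (by omega)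
    exact_mod_cast h

/-! ### Countable sums of supermartingales -/

/-- A computable sequence of rational supermartingales with geometrically decreasing initial
values sums to a computable test supermartingale. -/
theorem exists_computable_testSupermartingale {φ : ForecastingSystem} (hφ : ComputableSystem φ)
    (hnd : NonDegenerate φ) {F : Situation × ℕ → Frac} (hF : Computable F)
    (hsuper : ∀ i, IsSupermartingale φ fun s => ((F (s, i)).val : ℝ))
    (hinit : ∀ i, ((F ([], i)).val : ℝ) = (1 / 2) / 2 ^ i) :
    ∃ T : Situation → ℝ, IsTestSupermartingale φ T ∧ ComputableReal T ∧
      ∀ s i, ((F (s, i)).val : ℝ) ≤ T s := by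
  obtain ⟨C, hC, hbound⟩ := exists_supermartingale_bound hφ hnd
  have hnonneg : ∀ s i, (0 : ℝ) ≤ ((F (s, i)).val : ℝ) := fun s i => by
    exact_mod_cast Frac.val_nonneg _
  have hle : ∀ s i, ((F (s, i)).val : ℝ) ≤ C s * ((1 / 2) / 2 ^ i) := fun s i => by
    rw [← hinit]
    exact hbound _ (hsuper i) (fun s => hnonneg s i) [] s
  have hsummable : ∀ s, Summable fun i => ((F (s, i)).val : ℝ) := fun s =>
    Summable.of_nonneg_of_le (hnonneg s) (hle s) ((summable_geometric_two' _).mul_left _)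
  obtain ⟨G, hG, hGval⟩ := Frac.exists_computable_sum_range (F := fun s i => F (s, i)) hF
  have hGval' : ∀ s n, ((G (s, n)).val : ℝ) = ∑ i ∈ Finset.range n, ((F (s, i)).val : ℝ) :=
    fun s n => by rw [hGval]; push_cast; rfl
  have hGlim : ∀ s, Filter.Tendsto (fun n => ((G (s, n)).val : ℝ)) Filter.atTop
      (nhds (∑' i, ((F (s, i)).val : ℝ))) := fun s => by
    simp only [hGval']
    exact (hsummable s).hasSum.tendsto_sum_nat
  have hpow : ∀ n : ℕ, ((2 ^ n - 1 : ℕ) : ℚ) + 1 = 2 ^ n := fun n => by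
    rw [Nat.cast_sub Nat.one_le_two_pow]
    simp
  -- The remainder after `n` terms is at most `C s / 2 ^ n`; adding it to the partial sums
  -- approximates the total from above.
  have hrest : RecursiveRat fun x : Situation × ℕ =>
      (C x.1 : ℚ) / (((2 ^ x.2 - 1 : ℕ) : ℚ) + 1) :=
    recursiveRat_div_succ (hC.comp Computable.fst) (computable_nat_sub
      (computable_nat_pow (Computable.const 2) Computable.snd) (Computable.const 1))
  refine ⟨fun s => ∑' i, ((F (s, i)).val : ℝ), ⟨?_, fun s => tsum_nonneg (hnonneg s), ?_⟩,
    ⟨⟨fun x => (G x).val, Frac.recursiveRat_val hG, fun s n => ?_, hGlim⟩,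
      fun x => -((G x).val + (C x.1 : ℚ) / (((2 ^ x.2 - 1 : ℕ) : ℚ) + 1)),
      ((Frac.recursiveRat_val hG).add hrest).neg, fun s n => ?_, fun s => ?_⟩,
    fun s i => (hsummable s).le_tsum i fun j _ => hnonneg s j⟩
  · rw [isSupermartingale_iff]
    intro s p hp
    rw [← tsum_mul_left, ← tsum_mul_left, ← Summable.tsum_add ((hsummable _).mul_left _)
      ((hsummable _).mul_left _)]
    exact Summable.tsum_le_tsum (fun i => isSupermartingale_iff.1 (hsuper i) s p hp)
      (((hsummable _).mul_left _).add ((hsummable _).mul_left _)) (hsummable s)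
  · simp only [hinit]
    exact tsum_geometric_two' 1
  · simp only [hGval, Finset.sum_range_succ]
    exact le_add_of_nonneg_right (Frac.val_nonneg _)
  -- The new term is at most the amount by which the remainder bound drops, so the upper
  -- approximations are non-increasing.
  · have h1 : (F (s, n)).val ≤ (C s : ℚ) * ((1 / 2) / 2 ^ n) := by
      have := hle s n
      have h2 : ((F (s, n)).val : ℝ) ≤ (((C s : ℚ) * ((1 / 2) / 2 ^ n) : ℚ) : ℝ) := by
        push_cast; exact this
      exact_mod_cast h2
    have h2 : (C s : ℚ) / 2 ^ (n + 1) + C s * ((1 / 2) / 2 ^ n) = C s / 2 ^ n := by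
      rw [pow_succ]
      field_simp
      norm_num
    simp only [hGval, Finset.sum_range_succ, hpow]
    linarith
  · have h0 : Filter.Tendsto (fun n : ℕ => (C s : ℝ) / 2 ^ n) Filter.atTop (nhds 0) :=
      tendsto_const_nhds.div_atTop (tendsto_pow_atTop_atTop_of_one_lt one_lt_two)
    have h := ((hGlim s).add h0).neg
    rw [add_zero] at h
    refine h.congr fun n => ?_
    simp only [hpow]
    push_cast
    rfl

/-! ### Schnorr randomness implies Schnorr test randomness -/

theorem upperProb_mono {φ : ForecastingSystem} {G H : Set Path} (h : G ⊆ H) :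
    upperProb φ G ≤ upperProb φ H := by
  refine sInf_le_sInf (Set.image_mono fun M hM => ⟨hM.1, fun ω hω => le_trans ?_ (hM.2 ω hω)⟩)
  exact EReal.coe_le_coe_iff.2
    (Set.indicator_le_indicator_of_subset h (fun _ => zero_le_one) ω)

/-- The root is no child, so raising its value only relaxes a constraint. This normalises initial
values so that the sum starts at exactly one. -/
theorem IsSupermartingale.update_root {φ : ForecastingSystem} {M : Situation → ℝ}
    (hM : IsSupermartingale φ M) {c : ℝ} (hc : M [] ≤ c) :
    IsSupermartingale φ fun s => if s = [] then c else M s := by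
  rw [isSupermartingale_iff] at *
  intro s p hp
  simp only [List.append_eq_nil_iff, List.cons_ne_nil, and_false, if_false]
  split_ifs with hs
  · subst hs
    exact (hM [] p hp).trans hc
  · exact hM s p hp

theorem exists_computable_levels {f : ℕ × ℕ → ℕ} (hf : Computable f) :
    ∃ L : ℕ → ℕ, Computable L ∧ StrictMono L ∧ ∀ j, ∀ n ≤ j, f (j, n) ≤ L j := by
  have h1 : Computable fun i => 1 + ∑ n ∈ Finset.range (i + 1), f (i, n) :=
    computable_nat_add (Computable.const 1)
      (computable_sum_range (f := fun i n => f (i, n)) hf Computable.succ)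
  refine ⟨fun j => ∑ i ∈ Finset.range (j + 1), (1 + ∑ n ∈ Finset.range (i + 1), f (i, n)),
    computable_sum_range (f := fun _ i => 1 + ∑ n ∈ Finset.range (i + 1), f (i, n))
      (h1.comp Computable.snd) Computable.succ,
    strictMono_nat_of_lt_succ fun j => ?_, fun j n hn => ?_⟩
  · rw [Finset.sum_range_succ _ (j + 1)]
    omega
  · have h2 : f (j, n) ≤ ∑ n ∈ Finset.range (j + 1), f (j, n) :=
      Finset.single_le_sum (f := fun n => f (j, n)) (fun _ _ => Nat.zero_le _)
        (Finset.mem_range.2 (Nat.lt_succ_of_le hn))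
    dsimp only
    rw [Finset.sum_range_succ _ j]
    omega

/-- `ρ m` counts the `j` with `L (j + 1) ≤ m`. Strict monotonicity gives `j + 1 ≤ L (j + 1)`, so the
range `m` misses none of them. -/
theorem exists_growthFunction_of_levels {L : ℕ → ℕ} (hL : Computable L) (hmono : StrictMono L) :
    ∃ ρ, IsGrowthFunction ρ ∧ ∀ j m, m < L (j + 1) → ρ m ≤ j := by
  have hρ : ∀ m, ∑ j ∈ Finset.range m, (if L (j + 1) ≤ m then 1 else 0) =
      ((Finset.range m).filter fun j => L (j + 1) ≤ m).card := fun m => by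
    rw [Finset.card_filter]
  refine ⟨fun m => ((Finset.range m).filter fun j => L (j + 1) ≤ m).card, ⟨?_, ?_, ?_⟩, ?_⟩
  · refine (computable_sum_range (f := fun m j => if L (j + 1) ≤ m then 1 else 0)
      (n := fun m => m) ?_ Computable.id).of_eq hρ
    exact computable_ite (computablePred_nat_le (hL.comp (Computable.succ.comp Computable.snd))
      Computable.fst) (Computable.const 1) (Computable.const 0)
  · intro m m' h
    refine Finset.card_le_card fun j hj => ?_
    simp only [Finset.mem_filter, Finset.mem_range] at hj ⊢
    omega
  · rintro ⟨N, hN⟩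
    have h1 := hN ⟨L (N + 1), rfl⟩
    have h2 : Finset.range (N + 1) ⊆
        (Finset.range (L (N + 1))).filter fun j => L (j + 1) ≤ L (N + 1) := fun j hj => by
      rw [Finset.mem_range] at hj
      rw [Finset.mem_filter, Finset.mem_range]
      exact ⟨hj.trans_le (hmono.id_le _), hmono.monotone (by omega)⟩
    have h3 := Finset.card_le_card h2
    rw [Finset.card_range] at h3
    exact absurd (h3.trans h1) (by omega)
  · intro j m hm
    have h : ((Finset.range m).filter fun i => L (i + 1) ≤ m) ⊆ Finset.range j := fun i hi => by
      have h1 := hmono.lt_iff_lt.1 ((Finset.mem_filter.1 hi).2.trans_lt hm)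
      exact Finset.mem_range.2 (by omega)
    simpa using Finset.card_le_card h

theorem exists_mem_block {L : ℕ → ℕ} (hL : StrictMono L) {k : ℕ} (hk : L 0 ≤ k) :
    ∃ j, L j ≤ k ∧ k < L (j + 1) := by
  have h : ∃ j, k < L (j + 1) := ⟨k, (Nat.lt_succ_self k).trans_le (hL.id_le _)⟩
  refine ⟨Nat.find h, ?_, Nat.find_spec h⟩
  rcases hj : Nat.find h with _ | j
  · exact hk
  · exact not_lt.1 (Nat.find_min h (hj ▸ Nat.lt_succ_self j))

/-- A path cannot visit sets of arbitrarily small upper probability before a fixed time. -/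
theorem exists_forall_lt_upTo_notMem {φ : ForecastingSystem} (hc : ComputableSystem φ)
    (hnd : NonDegenerate φ) {S : ℕ → Set Situation} (hS : ∀ n, upperProb φ (cylSet (S n)) ≤
      (((1 / 2 : ℝ) ^ n : ℝ) : EReal)) (ω : Path) (N : ℕ) :
    ∃ n₀, ∀ n, n₀ ≤ n → ∀ k < N, ω.upTo k ∉ S n := by
  obtain ⟨C, -, hC⟩ := exists_supermartingale_bound hc hnd
  set c := C (ω.upTo N)
  -- A visit before depth `N` puts the whole cylinder of `ω.upTo N` into the event, so its upper
  -- probability is at least `1 / (c + 1)`, which exceeds `2 ^ (-n)` once `n ≥ c + 1`.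
  refine ⟨c + 1, fun n hn k hk hkS => ?_⟩
  have hsub : cyl (ω.upTo N) ⊆ cylSet (S n) := fun ω' hω' => by
    rw [mem_cyl_iff, Path.length_upTo] at hω'
    refine mem_cylSet_iff.2 ⟨k, ?_⟩
    rwa [← min_eq_left hk.le, ← Path.take_upTo, hω', Path.take_upTo, min_eq_left hk.le]
  have hpos : (0 : ℝ) < (c : ℝ) + 1 := by positivity
  have h1 : ((c : ℝ) + 1)⁻¹ ≤ (1 / 2 : ℝ) ^ n := by
    refine EReal.coe_le_coe_iff.1 ((le_upperProb fun M hM => ?_).trans (hS n))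
    have h2 : 1 ≤ c * M [] := (hM.one_le hsub).trans (hC M hM.1 hM.nonneg [] (ω.upTo N))
    rw [inv_le_iff_one_le_mul₀' hpos]
    linarith [hM.nonneg []]
  have h2 : (c : ℝ) + 1 < 2 ^ n := by exact_mod_cast hn.trans_lt Nat.lt_two_pow_self
  rw [one_div, inv_pow, inv_le_inv₀ hpos (by positivity)] at h1
  linarith

theorem SchnorrRandom.schnorrTestRandom {φ : ForecastingSystem} (hnd : NonDegenerate φ)
    (hc : ComputableSystem φ) {ω : Path} (h : SchnorrRandom φ ω) : SchnorrTestRandom φ ω := by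
  rintro G ⟨A, hA, hG, hprob, e, he, htail⟩ hω
  have hvisit : ∀ n, ∃ k, ω.upTo k ∈ sec A n := fun n => by
    rw [← mem_cylSet_iff, ← hG]
    exact Set.mem_iInter.1 hω n
  -- For `i = Nat.pair n j` the square dominates `i`. The remaining terms pay for the later factor
  -- `2 ^ j`, the approximation slack and the initial value `2 ^ (-(i + 1))`.
  let κ : ℕ → ℕ := fun n => (n + 1) ^ 2 + n + 2
  have hκ : Computable κ :=
    computable_nat_add (computable_nat_add
      (computable_nat_pow Computable.succ (Computable.const 2)) Computable.id)
      (Computable.const 2)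
  have hκpair : ∀ i, i + i.unpair.2 + 2 ≤ κ (max i.unpair.1 i.unpair.2) := fun i => by
    have h1 := Nat.pair_lt_max_add_one_sq i.unpair.1 i.unpair.2
    rw [Nat.pair_unpair] at h1
    have h2 := le_max_right i.unpair.1 i.unpair.2
    simp only [κ]
    omega
  obtain ⟨L, hL, hLmono, hLe⟩ := exists_computable_levels (f := fun p => e (κ p.1, κ p.2))
    (he.comp ((hκ.comp Computable.fst).pair (hκ.comp Computable.snd)))
  have hfst : Computable fun i : ℕ => i.unpair.1 := Computable.fst.comp Computable.unpair
  have hsnd : Computable fun i : ℕ => i.unpair.2 := Computable.snd.comp Computable.unpair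
  let A' : Set (ℕ × Situation) := {p | (κ p.1.unpair.1, p.2) ∈ A}
  have hA' : ComputablePred fun p => p ∈ A' :=
    computablePred_comp (p := fun p => p ∈ A)
      (f := fun p : ℕ × Situation => (κ p.1.unpair.1, p.2)) hA ((hκ.comp (hfst.comp Computable.fst)).pair Computable.snd)
  obtain ⟨F, hF, hFspec⟩ := hc.exists_computable_supermartingale hA'
    (ℓ := fun i => L i.unpair.2) (L := fun i => L (i.unpair.2 + 1))
    (K := fun i => i + i.unpair.2 + 1)
    (hL.comp hsnd) (hL.comp (Computable.succ.comp hsnd))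
    (computable_nat_add (computable_nat_add Computable.id hsnd) (Computable.const 1))
    (fun i => hLmono.monotone (Nat.le_succ _)) fun i => by
      have hdiff : cylSet (secLT A' i (L (i.unpair.2 + 1))) ⊆ cylSet (sec A (κ i.unpair.1)) :=
        fun ω' hω' => by
          obtain ⟨k, hk⟩ := mem_cylSet_iff.1 hω'
          exact mem_cylSet_iff.2 ⟨k, hk.1⟩
      have hbound : upperProb φ (cylSet (secLT A' i (L (i.unpair.2 + 1))) \
          cylSet (secLT A' i (L i.unpair.2))) ≤
          (((1 / 2 : ℝ) ^ κ (max i.unpair.1 i.unpair.2) : ℝ) : EReal) := by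
        -- For `n ≤ j` the tail bound applies at level `L j`; for `n > j` the bound on the whole `κ
        -- n`-th set is already small enough.
        rcases le_or_gt i.unpair.1 i.unpair.2 with hij | hij
        · rw [max_eq_right hij]
          exact (upperProb_mono (Set.sdiff_subset_sdiff_left hdiff)).trans
            (htail _ _ _ (hLe _ _ hij))
        · rw [max_eq_left hij.le]
          exact (upperProb_mono (Set.sdiff_subset.trans hdiff)).trans (hprob _)
      refine hbound.trans (EReal.coe_le_coe_iff.2 ?_)
      exact pow_le_pow_of_le_one (by norm_num) (by norm_num) (hκpair i)
  let F' : Situation × ℕ → Frac := fun x =>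
    if x.1 = [] then (1, 2 ^ (x.2 + 1) - 1) else Frac.mul (2 ^ x.2.unpair.2, 0) (F x)
  have hF' : Computable F' := by
    refine computable_ite (p := fun x : Situation × ℕ => x.1 = []) ?_
      ((Computable.const 1).pair (computable_nat_sub (computable_nat_pow (Computable.const 2)
        (Computable.succ.comp Computable.snd)) (Computable.const 1)))
      (Frac.computable_mul ((computable_nat_pow (Computable.const 2)
        (hsnd.comp Computable.snd)).pair (Computable.const 0)) hF)
    exact (computablePred_nat_le (Computable.list_length.comp Computable.fst)
      (Computable.const 0)).of_eq fun x => by simp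
  have hF'val : ∀ s i, ((F' (s, i)).val : ℝ) =
      if s = [] then (1 / 2) / 2 ^ i else 2 ^ i.unpair.2 * ((F (s, i)).val : ℝ) := fun s i => by
    simp only [F']
    split_ifs
    · simp only [Frac.val]
      rw [Nat.cast_sub Nat.one_le_two_pow, pow_succ]
      push_cast
      rw [sub_add_cancel, div_div, mul_comm]
    · simp
  obtain ⟨T, hT, hTc, hTle⟩ := exists_computable_testSupermartingale hc hnd hF' (fun i => by
    simp only [hF'val]
    refine ((hFspec i).1.const_mul (c := 2 ^ i.unpair.2) (by positivity)).update_root ?_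
    have h1 : ((F ([], i)).val : ℝ) * (2 ^ (i + i.unpair.2 + 1) : ℕ) ≤ 1 := by
      exact_mod_cast (hFspec i).2.1
    rw [div_div, le_div_iff₀ (by positivity)]
    refine le_trans (le_of_eq ?_) h1
    push_cast
    ring) fun i => by rw [hF'val, if_pos rfl]
  obtain ⟨ρ, hρ, hρle⟩ := exists_growthFunction_of_levels hL hLmono
  refine h T hT hTc ⟨ρ, hρ, ?_⟩
  refine lt_of_lt_of_le (b := ((1 : ℝ) : EReal)) (by norm_num)
    (Filter.le_limsup_of_frequently_le ?_ (by isBoundedDefault))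
  refine Filter.frequently_atTop.2 fun N => ?_
  -- The bound `L 0 + 1` places the visit in some block and away from the root, where `F'` has been
  -- altered.
  obtain ⟨n, hn⟩ := exists_forall_lt_upTo_notMem hc hnd hprob ω (max N (L 0 + 1))
  have hnκ : n ≤ κ n := by simp only [κ]; omega
  classical
  -- The first visit is needed: the block supermartingale is known to be one only when no visit
  -- precedes the block.
  have hk := Nat.find_spec (hvisit (κ n))
  have hkmin := fun m hm => Nat.find_min (hvisit (κ n)) (m := m) hm
  generalize Nat.find (hvisit (κ n)) = k at hk hkmin
  have hkN : max N (L 0 + 1) ≤ k := not_lt.1 fun hlt => hn _ hnκ k hlt hk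
  obtain ⟨j, hj1, hj2⟩ := exists_mem_block hLmono (by omega : L 0 ≤ k)
  refine ⟨k, (le_max_left _ _).trans hkN, EReal.coe_le_coe_iff.2 ?_⟩
  have hne : ω.upTo k ≠ [] := fun h0 => by
    have := congrArg List.length h0
    simp only [Path.length_upTo, List.length_nil] at this
    omega
  have hsec : sec A' (Nat.pair n j) = sec A (κ n) := by
    ext s
    simp [sec, A']
  have hFone := (hFspec (Nat.pair n j)).2.2 (ω.upTo k) k (by simp)
    (by simpa using hj2) (by rw [hsec, Path.take_upTo, min_self]; exact hk) fun m hm => by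
      simp only [Nat.unpair_pair] at hm
      rw [hsec, Path.take_upTo, min_eq_left (by omega)]
      exact hkmin m (by omega)
  have h1 := hTle (ω.upTo k) (Nat.pair n j)
  rw [hF'val, if_neg hne, hFone, Nat.unpair_pair] at h1
  -- Since `ρ k ≤ j`, the capital `2 ^ j` exceeds `ρ k` by at least one, which keeps the limit
  -- superior positive.
  have h2 : (ρ k : ℝ) + 1 ≤ 2 ^ j := by
    exact_mod_cast (Nat.succ_le_succ (hρle j k hj2)).trans Nat.lt_two_pow_self
  simp only [Rat.cast_one, mul_one] at h1
  linarith

end Forecasting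

theorem mainTheorem2 (φ : Forecasting.ForecastingSystem)
    (hφ : Forecasting.NonDegenerate φ) (hc : Forecasting.ComputableSystem φ)
    (ω : Forecasting.Path) :
    Forecasting.SchnorrRandom φ ω ↔ Forecasting.SchnorrTestRandom φ ω :=
  ⟨fun h => h.schnorrTestRandom hφ hc, fun h => h.schnorrRandom⟩
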